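/- Let $S^2\subset\mathbb R^3$ be the unit sphere with the round metric $g_0$ and area element $dv_{g_0}$ (total area $4\pi$), and let $x_3$ be the third coordinate function. Let $p_1=(0,0,1)$ and $p_2=-p_1$. For $p\in S^2$ let $G_p$ be the Green function, continuous on $S^2\setminus\{p\}$, given by $$-\Delta G_p=\delta_p-\frac1{4\pi}\ \text{ on } S^2,\qquad \int_{S^2}G_p\,dv_{g_0}=0 .$$ Let $\alpha_1,\alpha_2\in(-1,\infty)$, let $K\in C^\infty(S^2)$ be positive (for instance $K\equiv1$), let $\rho>0$, and put $$h=K\,e^{-4\pi\alpha_1G_{p_1}-4\pi\alpha_2G_{p_2}} .$$ Let $u\in L^1(S^2)$ with $he^u\in L^1(S^2)$ be a solution, in the sense of distributions on $S^2$, of $$-\Delta u=\rho\left(\frac{he^u}{\int_{S^2}he^u\,dv_{g_0}}-\frac1{4\pi}\right)$$ (this includes all weak solutions $u\in H^1(S^2)$). Then $\nabla h\cdot\nabla x_3\,e^u$ and $he^ux_3$ are integrable on $S^2$, and $$\int_{S^2}\nabla h\cdot\nabla x_3\;e^u\,dv_{g_0}=\left(2-\frac{\rho}{4\pi}\right)\int_{S^2}he^u\,x_3\,dv_{g_0}.$$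 -/

import Mathlib

open MeasureTheory
open scoped Manifold ContDiff

noncomputable section

namespace SingularLiouville

/-- The standard unit sphere `S²` in `ℝ³`. -/
abbrev S2 : Type := Metric.sphere (0 : EuclideanSpace ℝ (Fin 3)) 1

/-- The standard area measure `dv_{g₀}` on `S²` (of total mass `4π`). -/
def area : Measure S2 := (volume : Measure (EuclideanSpace ℝ (Fin 3))).toSphere

/-- The third Euclidean coordinate, as a function on `S²`. -/
def x3 (x : S2) : ℝ := (x : EuclideanSpace ℝ (Fin 3)) 2

/-- Smooth real functions on `S²`, for the manifold structure of Mathlib. -/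
def IsSmooth (f : S2 → ℝ) : Prop := ContMDiff (𝓡 2) 𝓘(ℝ) ∞ f

/-- The radially constant extension `x ↦ f (x / ‖x‖)` of `f` to `ℝ³ ∖ {0}` (and `0` at the
origin). -/
def radialExt (f : S2 → ℝ) (x : EuclideanSpace ℝ (Fin 3)) : ℝ :=
  open Classical in
  if hx : x ≠ 0 then
    f ⟨‖x‖⁻¹ • x, by
      rw [mem_sphere_zero_iff_norm, norm_smul, norm_inv, norm_norm,
        inv_mul_cancel₀ (norm_ne_zero_iff.mpr hx)]⟩
  else 0

/-- The gradient on the round sphere: the Euclidean gradient, at a point of the sphere, of the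
radially constant extension. It is tangent to the sphere. -/
def grad (f : S2 → ℝ) (x : S2) : EuclideanSpace ℝ (Fin 3) :=
  gradient (radialExt f) (x : EuclideanSpace ℝ (Fin 3))

/-- The Laplace–Beltrami operator of the round sphere (the analysts' sign, nonpositive): the
Euclidean Laplacian, at a point of the sphere, of the radially constant extension. -/
def lap (f : S2 → ℝ) (x : S2) : ℝ :=
  Laplacian.laplacian (radialExt f) (x : EuclideanSpace ℝ (Fin 3))

/-- `G` is the Green function of `S²` with pole `p`: `-Δ G = δ_p - 1 / |S²|` in the sense of
distributions and `∫ G = 0`. Continuity away from `p` selects the pointwise representative off `p`;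
the value at `p` itself is immaterial. -/
structure IsGreenFunction (p : S2) (G : S2 → ℝ) : Prop where
  integrable : Integrable G area
  continuousOn : ContinuousOn G {p}ᶜ
  equation : ∀ φ : S2 → ℝ, IsSmooth φ →
    -∫ x, G x * lap φ x ∂area = φ p - 1 / (4 * Real.pi) * ∫ x, φ x ∂area
  integral_eq_zero : ∫ x, G x ∂area = 0

/-- The singular weight `h = K e^{-4π α₁ G₁ - 4π α₂ G₂}`. -/
def weight (K G₁ G₂ : S2 → ℝ) (α₁ α₂ : ℝ) (x : S2) : ℝ :=
  K x * Real.exp (-4 * Real.pi * α₁ * G₁ x - 4 * Real.pi * α₂ * G₂ x)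

/-- `u` solves `-Δ u = ρ (h e^u / ∫ h e^u - 1 / |S²|)` on `S²` in the sense of distributions.
Both `u` and `h e^u` are required to be integrable, which is what the equation needs in order to
make sense. -/
structure IsSolution (h : S2 → ℝ) (ρ : ℝ) (u : S2 → ℝ) : Prop where
  integrable : Integrable u area
  integrable_exp : Integrable (fun x => h x * Real.exp (u x)) area
  equation : ∀ φ : S2 → ℝ, IsSmooth φ →
    -∫ x, u x * lap φ x ∂area =
      ρ * ((∫ x, h x * Real.exp (u x) * φ x ∂area) / (∫ x, h x * Real.exp (u x) ∂area)
        - 1 / (4 * Real.pi) * ∫ x, φ x ∂area)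

end SingularLiouville

end

/-!
The identity is the Pohozaev (Kazdan–Warner) identity for the conformal field `X = ∇ x₃`, that is
`X(x) = p - ⟨x, p⟩ x` with `p = p₁`, whose divergence is `-2 x₃`. Write `f = h e^u` and `M = ∫ f`.
Formally `∫ X(h) e^u = ∫ X(f) - ∫ f X(u) = 2 ∫ f x₃ - ∫ f X(u)`, and the equation turns the last
integral into `ρ / (4 π) ∫ f x₃`. As `u` and `f` are only integrable, the argument avoids regularity
theory and works with the logarithmic kernel `log (1 - ⟨x, y⟩)`.

* The divergence theorem `∫ X(g) = 2 ∫ g x₃` (`integral_conformal_field`) follows from the vanishing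
  of the integral over `ℝ³` of the derivative, in the direction `p`, of the radial extension of `g`
  times a Gaussian. Nothing is required of `g` at the zeros `± p` of `X`, because these span a line
  in the direction of differentiation; so no cut-off near the singularities of `h` is needed.
* `Δ log (a - ⟨x, y⟩) = (a² - 1) / (a - ⟨x, y⟩)² - 1` for `a > 1`, and the first term is a positive
  kernel of mass `4 π` which concentrates at `y` as `a → 1`. Testing an equation with this logarithm
  thus represents its solution by a logarithmic potential (`HasLaplacian.ae_eq`). For the Green
  functions this gives `G_p = c - log (1 - ⟨x, p⟩) / (4 π)`, so that off the poles
  `h = k K (1 - x₃)^α₁ (1 + x₃)^α₂` and `X(h) = h B` with `B` bounded; for the solution it gives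
  `u(x) = c - b ∫ f(y) log (1 - ⟨x, y⟩) dy` with `b = ρ / (4 π M)`.
* Let `u_a` be this potential with `log (a - ⟨x, y⟩)` as kernel. It is differentiable, and
  `u_a ≤ u`, so `h e^{u_a} ≤ f`. The divergence theorem for `h e^{u_a}` reads
  `∫ h e^{u_a} B + b ∬ h(x) e^{u_a(x)} f(y) ⟨X(x), y⟩ / (a - ⟨x, y⟩) = 2 ∫ h e^{u_a} x₃`.
  As `a → 1` the single integrals are dominated by `f`. In the limit of the double integral the
  kernel symmetrizes, `⟨X(x), y⟩ + ⟨X(y), x⟩ = (⟨x, p⟩ + ⟨y, p⟩) (1 - ⟨x, y⟩)`, and its value is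
  `M ∫ f x₃` (`integral_interaction`, `pohozaev_identity`).
* The double integrals are dominated by the interaction energy
  `∬ f(x) f(y) |⟨X(x), y⟩| / (1 - ⟨x, y⟩)`, which is finite (`integrable_interaction`) once
  `f² r^(2 - 2 η)` is integrable, `r = |X|` being the distance to the axis. Since
  `h = O(r^(-2 + 2 η))` for small `η > 0`, this is an exponential integrability property of
  logarithmic potentials of `L¹` densities (`integrable_weight_mul_exp_potential`), obtained from
  Jensen's inequality after splitting off a bounded part of the density.
-/

namespace SingularLiouville

open Set Filter Topology Pointwise

/-! ### Radial extensions and polar coordinates -/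

/-- The ambient Euclidean space `ℝ³`. -/
abbrev R3 : Type := EuclideanSpace ℝ (Fin 3)

/-- The Euclidean scalar product of two points of the sphere, the cosine of their distance. -/
noncomputable def dot (x y : S2) : ℝ := inner ℝ (x : R3) (y : R3)

instance : IsFiniteMeasure area := inferInstanceAs (IsFiniteMeasure (Measure.toSphere _))

instance : Measure.IsOpenPosMeasure area :=
  inferInstanceAs (Measure.IsOpenPosMeasure (Measure.toSphere _))

@[simp] lemma norm_coe (x : S2) : ‖(x : R3)‖ = 1 := norm_eq_of_mem_sphere x

lemma coe_ne_zero (x : S2) : (x : R3) ≠ 0 := ne_zero_of_mem_unit_sphere x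

lemma radialExt_smul (f : S2 → ℝ) {r : ℝ} (hr : 0 < r) (z : R3) :
    radialExt f (r • z) = radialExt f z := by
  unfold radialExt
  by_cases hz : z = 0
  · simp [hz]
  · have h : r • z ≠ 0 := smul_ne_zero hr.ne' hz
    rw [dif_pos h, dif_pos hz]
    congr 2
    rw [norm_smul, Real.norm_of_nonneg hr.le, smul_smul, mul_inv, mul_comm r⁻¹, mul_assoc,
      inv_mul_cancel₀ hr.ne', mul_one]

@[simp] lemma radialExt_coe (f : S2 → ℝ) (x : S2) : radialExt f x = f x := by
  unfold radialExt
  rw [dif_pos (coe_ne_zero x)]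
  congr 1
  ext1
  simp

lemma radialExt_zero (f : S2 → ℝ) : radialExt f 0 = 0 := by
  simp [radialExt]

lemma exists_smul_coe {z : R3} (hz : z ≠ 0) : ∃ r : ℝ, 0 < r ∧ ∃ x : S2, z = r • (x : R3) :=
  ⟨‖z‖, norm_pos_iff.2 hz, ⟨‖z‖⁻¹ • z, by
    rw [mem_sphere_zero_iff_norm, norm_smul, norm_inv, norm_norm,
      inv_mul_cancel₀ (norm_ne_zero_iff.mpr hz)]⟩, by
    simp [smul_smul, norm_ne_zero_iff.mpr hz]⟩

lemma continuous_dot : Continuous fun p : S2 × S2 => dot p.1 p.2 := by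
  unfold dot; fun_prop

@[fun_prop] lemma continuous_dot_left (y : S2) : Continuous fun x => dot x y := by
  unfold dot; fun_prop

@[fun_prop] lemma continuous_dot_right (x : S2) : Continuous fun y => dot x y := by
  unfold dot; fun_prop

lemma dot_comm (x y : S2) : dot x y = dot y x := real_inner_comm _ _

@[simp] lemma dot_self (x : S2) : dot x x = 1 := by simp [dot]

lemma dot_le_one (x y : S2) : dot x y ≤ 1 := by
  have := real_inner_le_norm (x : R3) y
  simpa [dot] using this

lemma neg_one_le_dot (x y : S2) : -1 ≤ dot x y := by
  have := neg_le_of_abs_le (abs_real_inner_le_norm (x : R3) y)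
  simpa [dot] using this

lemma dot_neg_right (x y : S2) : dot x (-y) = -dot x y := by simp [dot]

lemma dot_eq_one_iff {x y : S2} : dot x y = 1 ↔ x = y := by
  rw [dot, inner_eq_one_iff_of_norm_eq_one (norm_coe x) (norm_coe y), Subtype.coe_inj]

lemma dot_eq_neg_one_iff {x y : S2} : dot x y = -1 ↔ x = -y := by
  rw [← dot_eq_one_iff, dot_neg_right, neg_eq_iff_eq_neg]

lemma dot_lt_one {x y : S2} (h : x ≠ y) : dot x y < 1 :=
  lt_of_le_of_ne (dot_le_one x y) (fun h' => h (dot_eq_one_iff.1 h'))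

lemma neg_one_lt_dot {x y : S2} (h : x ≠ -y) : -1 < dot x y :=
  lt_of_le_of_ne (neg_one_le_dot x y) (fun h' => h (dot_eq_neg_one_iff.1 h'.symm))

/-- Integration in polar coordinates in `ℝ³`, for a product of a function of the direction and a
function of the radius. -/
lemma integral_radialExt_mul (f : S2 → ℝ) (φ : ℝ → ℝ) :
    ∫ z : R3, radialExt f z * φ ‖z‖ = (∫ x, f x ∂area) * ∫ r in Ioi (0 : ℝ), r ^ 2 * φ r := by
  have h2 : Module.finrank ℝ R3 - 1 = 2 := by simp
  calc
    ∫ z : R3, radialExt f z * φ ‖z‖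
      = ∫ z : ({(0 : R3)}ᶜ : Set R3), radialExt f z * φ ‖(z : R3)‖
          ∂((volume : Measure R3).comap (↑)) := by
        rw [integral_subtype_comap (measurableSet_singleton _).compl
          fun z : R3 => radialExt f z * φ ‖z‖, restrict_compl_singleton]
    _ = ∫ p : S2 × Ioi (0 : ℝ), f p.1 * φ p.2 ∂(area.prod (.volumeIoiPow 2)) := by
        rw [← h2]
        rw [area, ← ((volume : Measure R3).measurePreserving_homeomorphUnitSphereProd).integral_comp
          (Homeomorph.measurableEmbedding _) fun p : S2 × Ioi (0 : ℝ) => f p.1 * φ p.2]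
        refine integral_congr_ae (.of_forall fun z => ?_)
        have hz : (z : R3) ≠ 0 := z.2
        simp only [radialExt, dif_pos hz]
        congr 2
        · ext1; simp
        · simp
    _ = (∫ x, f x ∂area) * ∫ r : Ioi (0 : ℝ), φ r ∂(.volumeIoiPow 2) :=
        integral_prod_mul f fun r : Ioi (0 : ℝ) => φ r
    _ = _ := by
        congr 1
        simp only [Measure.volumeIoiPow, ENNReal.ofReal]
        rw [integral_withDensity_eq_integral_smul,
          integral_subtype_comap measurableSet_Ioi fun a ↦ Real.toNNReal (a ^ 2) • φ a]
        · refine setIntegral_congr_fun measurableSet_Ioi fun x hx ↦ ?_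
          simp [NNReal.smul_def, sq_nonneg x]
        · exact (measurable_subtype_coe.pow_const _).real_toNNReal

lemma integrable_radialExt_mul {f : S2 → ℝ} {φ : ℝ → ℝ} (hf : Integrable f area)
    (hφ : IntegrableOn (fun r => r ^ 2 * φ r) (Ioi 0)) :
    Integrable fun z : R3 => radialExt f z * φ ‖z‖ := by
  have h2 : Module.finrank ℝ R3 - 1 = 2 := by simp
  have h3 : Integrable (fun r : Ioi (0 : ℝ) => φ r) (.volumeIoiPow 2) := by
    simp only [Measure.volumeIoiPow, ENNReal.ofReal]
    rw [integrable_withDensity_iff_integrable_smul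
      ((measurable_subtype_coe.pow_const _).real_toNNReal),
      ← Function.comp_def (fun r : ℝ => Real.toNNReal (r ^ 2) • φ r)
        (Subtype.val : Ioi (0 : ℝ) → ℝ),
      ← integrableOn_iff_comap_subtypeVal measurableSet_Ioi]
    refine hφ.congr_fun (fun r hr => ?_) measurableSet_Ioi
    simp [NNReal.smul_def, sq_nonneg r]
  have h4 := hf.mul_prod h3
  rw [area, ← h2,
    ← (volume : Measure R3).measurePreserving_homeomorphUnitSphereProd.integrable_comp_emb
      (Homeomorph.measurableEmbedding _)] at h4
  have h5 : Integrable (fun z : ({(0 : R3)}ᶜ : Set R3) => radialExt f z * φ ‖(z : R3)‖)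
      ((volume : Measure R3).comap (↑)) := by
    refine h4.congr (.of_forall fun z => ?_)
    have hz : (z : R3) ≠ 0 := z.2
    simp only [radialExt, dif_pos hz, Function.comp]
    congr 2
    · ext1; simp
    · simp
  rw [← Function.comp_def (fun z : R3 => radialExt f z * φ ‖z‖),
    ← integrableOn_iff_comap_subtypeVal (measurableSet_singleton (0 : R3)).compl,
    IntegrableOn, restrict_compl_singleton] at h5
  exact h5

/-! ### The divergence theorem for conformal fields -/

instance : NullSingletonClass area := ⟨fun y => by
  rw [area, Measure.toSphere_apply' _ (measurableSet_singleton y)]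
  have h : Ioo (0 : ℝ) 1 • ((↑) '' ({y} : Set S2) : Set R3) ⊆
      ((Submodule.span ℝ {(y : R3)} : Submodule ℝ R3) : Set R3) := by
    rintro _ ⟨r, -, _, ⟨x, rfl, rfl⟩, rfl⟩
    exact Submodule.smul_mem _ _ (Submodule.mem_span_singleton_self _)
  have h2 : (Submodule.span ℝ {(y : R3)} : Submodule ℝ R3) ≠ ⊤ := fun h => by
    have h3 := finrank_span_singleton (K := ℝ) (coe_ne_zero y)
    rw [h] at h3
    simp at h3
  rw [measure_mono_null h (Measure.addHaar_submodule volume _ h2), mul_zero]⟩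

lemma radialExt_mul (f g : S2 → ℝ) (z : R3) :
    radialExt (fun x => f x * g x) z = radialExt f z * radialExt g z := by
  unfold radialExt
  split_ifs <;> simp

lemma norm_mul_radialExt_dot (y : S2) (z : R3) :
    ‖z‖ * radialExt (fun x => dot x y) z = inner ℝ z (y : R3) := by
  by_cases hz : z = 0
  · simp [hz]
  · obtain ⟨r, hr, x, rfl⟩ := exists_smul_coe hz
    rw [radialExt_smul _ hr, radialExt_coe, norm_smul, norm_coe, Real.norm_of_nonneg hr.le,
      real_inner_smul_left, mul_one, dot]

lemma eq_or_eq_neg_of_smul_mem_span {x y : S2} {r : ℝ} (hr : r ≠ 0)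
    (h : r • (x : R3) ∈ Submodule.span ℝ {(y : R3)}) : x = y ∨ x = -y := by
  obtain ⟨c, hc⟩ := Submodule.mem_span_singleton.1 ((Submodule.smul_mem_iff _ hr).1 h)
  have h1 : |c| = 1 := by simpa [norm_smul] using congrArg norm hc
  rcases eq_or_eq_neg_of_abs_eq h1 with rfl | rfl
  · left; ext1; simpa using hc.symm
  · right; ext1; simpa using hc.symm

/-- Line derivatives of a radial extension are homogeneous of degree `-1`. -/
lemma hasLineDerivAt_radialExt_smul {g : S2 → ℝ} {d : ℝ} {x v : R3} {r : ℝ} (hr : 0 < r)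
    (h : HasLineDerivAt ℝ (radialExt g) d x v) :
    HasLineDerivAt ℝ (radialExt g) (d * r⁻¹) (r • x) v := by
  unfold HasLineDerivAt at h ⊢
  have h1 : HasDerivAt (fun t : ℝ => t * r⁻¹) r⁻¹ 0 := by
    simpa using (hasDerivAt_id (0 : ℝ)).mul_const r⁻¹
  have h2 := HasDerivAt.comp (𝕜 := ℝ) (0 : ℝ) (h₂ := fun t => radialExt g (x + t • v))
    (h₂' := d) (h := fun t : ℝ => t * r⁻¹) (by simpa using h) h1
  refine h2.congr_of_eventuallyEq (.of_forall fun t => ?_)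
  simp only [Function.comp]
  rw [← radialExt_smul g hr (x + (t * r⁻¹) • v), smul_add, smul_smul, mul_comm t, ← mul_assoc,
    mul_inv_cancel₀ hr.ne', one_mul]

lemma integral_mul_exp_neg_sq :
    ∫ r in Ioi (0 : ℝ), r ^ 2 * (r⁻¹ * Real.exp (-r ^ 2)) = 1 / 2 := by
  have h := integral_rpow_mul_exp_neg_rpow (p := 2) (q := 1) (by norm_num) (by norm_num)
  have e : ((1 : ℝ) + 1) / 2 = 1 := by norm_num
  rw [e, Real.Gamma_one, mul_one] at h
  rw [← h]
  refine setIntegral_congr_fun measurableSet_Ioi fun r (hr : 0 < r) => ?_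
  simp only [Real.rpow_one, Real.rpow_two]
  field_simp

lemma integrableOn_mul_exp_neg_sq :
    IntegrableOn (fun r : ℝ => r ^ 2 * (r⁻¹ * Real.exp (-r ^ 2))) (Ioi 0) := by
  have h := integrableOn_rpow_mul_exp_neg_rpow (p := 2) (s := 1) (by norm_num) (by norm_num)
  refine h.congr_fun (fun r (hr : 0 < r) => ?_) measurableSet_Ioi
  simp only [Real.rpow_one, Real.rpow_two]
  field_simp

lemma integral_pow_three_mul_exp_neg_sq :
    ∫ r in Ioi (0 : ℝ), r ^ 2 * (2 * r * Real.exp (-r ^ 2)) = 1 := by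
  have h := integral_rpow_mul_exp_neg_rpow (p := 2) (q := 3) (by norm_num) (by norm_num)
  have e : ((3 : ℝ) + 1) / 2 = 1 + 1 := by norm_num
  rw [e, Real.Gamma_add_one one_ne_zero, Real.Gamma_one] at h
  have h' : (1 : ℝ) = 2 * (1 / 2 * (1 * 1)) := by norm_num
  rw [h', ← h, ← integral_const_mul]
  refine setIntegral_congr_fun measurableSet_Ioi fun r (hr : 0 < r) => ?_
  simp only [Real.rpow_ofNat]
  ring

lemma integrableOn_pow_three_mul_exp_neg_sq :
    IntegrableOn (fun r : ℝ => r ^ 2 * (2 * r * Real.exp (-r ^ 2))) (Ioi 0) := by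
  have h := (integrableOn_rpow_mul_exp_neg_rpow (p := 2) (s := 3) (by norm_num)
    (by norm_num)).const_mul 2
  refine IntegrableOn.congr_fun h (fun r (hr : 0 < r) => ?_) measurableSet_Ioi
  simp only [Real.rpow_ofNat]
  ring

lemma ae_ne_poles (y : S2) : ∀ᵐ x ∂area, x ≠ y ∧ x ≠ -y := by
  filter_upwards [(measure_eq_zero_iff_ae_notMem.1 (measure_singleton y) :
      ∀ᵐ x ∂area, x ∉ ({y} : Set S2)),
    (measure_eq_zero_iff_ae_notMem.1 (measure_singleton (-y)) : ∀ᵐ x ∂area, x ∉ ({-y} : Set S2))]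
    with x h1 h2
  exact ⟨h1, h2⟩

/-- The divergence theorem for the conformal field `X = y - ⟨x, y⟩ x`, whose divergence is
`-2 ⟨x, y⟩`: if `d = X g` off the zeros `± y` of the field, then `∫ X g = 2 ∫ g ⟨x, y⟩`.
The points `± y` need no regularity: they span the only line in direction `y` in `ℝ³` along which
the radial extension of `g` can fail to be differentiable, and there it may be replaced by `0`. -/
theorem integral_conformal_field (y : S2) {g d : S2 → ℝ}
    (hg : ∀ x : S2, x ≠ y → x ≠ -y → HasLineDerivAt ℝ (radialExt g) (d x) (x : R3) (y : R3))
    (hgi : Integrable g area) (hdi : Integrable d area) :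
    ∫ x, d x ∂area = 2 * ∫ x, g x * dot x y ∂area := by
  classical
  set A : Set S2 := {y, -y}ᶜ with hA
  have hmem : ∀ {x}, x ≠ y → x ≠ -y → x ∈ A := fun h1 h2 => by simp [hA, h1, h2]
  have hAae : ∀ᵐ x ∂area, x ∈ A := (ae_ne_poles y).mono fun x hx => hmem hx.1 hx.2
  set g' := A.indicator g
  set d' := A.indicator d
  have hg' : g' =ᵐ[area] g := hAae.mono fun x hx => indicator_of_mem hx g
  have hd' : d' =ᵐ[area] d := hAae.mono fun x hx => indicator_of_mem hx d
  have hgi' : Integrable g' area := hgi.congr hg'.symm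
  have hdi' : Integrable d' area := hdi.congr hd'.symm
  have hgy : Integrable (fun x => g' x * dot x y) area := by
    refine hgi'.mul_bdd (c := 1) (by fun_prop) (.of_forall fun x => ?_)
    rw [Real.norm_eq_abs, abs_le]
    exact ⟨neg_one_le_dot x y, dot_le_one x y⟩
  -- the radial extension of `g'` vanishes on the axis spanned by `y`
  have haxis : ∀ (f : S2 → ℝ) (z : R3), z ∈ Submodule.span ℝ {(y : R3)} →
      radialExt (A.indicator f) z = 0 := by
    intro f z hz
    by_cases h0 : z = 0
    · rw [h0, radialExt_zero]
    obtain ⟨r, hr, x, rfl⟩ := exists_smul_coe h0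
    rw [radialExt_smul _ hr, radialExt_coe, indicator_of_notMem]
    rcases eq_or_eq_neg_of_smul_mem_span hr.ne' hz with h | h <;> simp [hA, h]
  have hoff : ∀ (f : S2 → ℝ) (z : R3), z ∉ Submodule.span ℝ {(y : R3)} →
      radialExt (A.indicator f) z = radialExt f z := by
    intro f z hz
    have h0 : z ≠ 0 := fun h => hz (by rw [h]; exact Submodule.zero_mem _)
    obtain ⟨r, hr, x, rfl⟩ := exists_smul_coe h0
    rw [radialExt_smul _ hr, radialExt_coe, radialExt_smul _ hr, radialExt_coe, indicator_of_mem]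
    refine hmem ?_ ?_ <;> rintro rfl <;> apply hz
    · exact Submodule.smul_mem _ _ (Submodule.mem_span_singleton_self _)
    · rw [Submodule.mem_span_singleton]; exact ⟨-r, by simp⟩
  have hline : ∀ (z : R3) (t : ℝ), z + t • (y : R3) ∈ Submodule.span ℝ {(y : R3)} ↔
      z ∈ Submodule.span ℝ {(y : R3)} := fun z t =>
    Submodule.add_mem_iff_left _ (Submodule.smul_mem _ _ (Submodule.mem_span_singleton_self _))
  set φ₁ : ℝ → ℝ := fun r => r⁻¹ * Real.exp (-r ^ 2)
  set φ₂ : ℝ → ℝ := fun r => 2 * r * Real.exp (-r ^ 2)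
  set Ψ : R3 → ℝ := fun z => radialExt g' z * Real.exp (-‖z‖ ^ 2)
  set Ψ' : R3 → ℝ := fun z => radialExt d' z * φ₁ ‖z‖
    - radialExt (fun x => g' x * dot x y) z * φ₂ ‖z‖
  have hderiv : ∀ z : R3, HasLineDerivAt ℝ Ψ (Ψ' z) z (y : R3) := by
    intro z
    by_cases hz : z ∈ Submodule.span ℝ {(y : R3)}
    · have e : Ψ' z = 0 := by
        simp only [Ψ', radialExt_mul]
        rw [haxis d z hz, haxis g z hz]; ring
      rw [e]
      unfold HasLineDerivAt
      refine (hasDerivAt_const (0 : ℝ) (0 : ℝ)).congr_of_eventuallyEq (.of_forall fun t => ?_)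
      simp only [Ψ]
      rw [haxis g _ ((hline z t).2 hz), zero_mul]
    · have h0 : z ≠ 0 := fun h => hz (by rw [h]; exact Submodule.zero_mem _)
      obtain ⟨r, hr, x, rfl⟩ := exists_smul_coe h0
      have hxy : x ≠ y ∧ x ≠ -y := by
        constructor <;> rintro rfl <;> apply hz
        · exact Submodule.smul_mem _ _ (Submodule.mem_span_singleton_self _)
        · rw [Submodule.mem_span_singleton]; exact ⟨-r, by simp⟩
      have h1 := hasLineDerivAt_radialExt_smul hr (hg x hxy.1 hxy.2)
      unfold HasLineDerivAt at h1 ⊢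
      have h2 : HasDerivAt (fun t : ℝ => radialExt g' (r • (x : R3) + t • (y : R3)))
          (d x * r⁻¹) 0 := h1.congr_of_eventuallyEq (.of_forall fun t =>
            hoff g _ (fun h => hz ((hline _ t).1 h)))
      have h3 : HasDerivAt (fun t : ℝ => r • (x : R3) + t • (y : R3)) (y : R3) 0 := by
        simpa using ((hasDerivAt_id (0 : ℝ)).smul_const (y : R3)).const_add (r • (x : R3))
      have h4 : HasDerivAt (fun t : ℝ => Real.exp (-‖r • (x : R3) + t • (y : R3)‖ ^ 2))
          (Real.exp (-‖r • (x : R3)‖ ^ 2) * -(2 * inner ℝ (r • (x : R3)) (y : R3))) 0 := by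
        have h := h3.norm_sq.fun_neg.exp
        rwa [zero_smul, add_zero] at h
      have h5 := h2.mul h4
      refine h5.congr_deriv ?_
      simp only [Ψ', radialExt_mul, φ₁, φ₂]
      have h6 := norm_mul_radialExt_dot y (r • (x : R3))
      rw [zero_smul, add_zero, ← h6]
      simp only [g', d']
      rw [hoff d _ hz, radialExt_smul d hr, radialExt_coe]
      rw [norm_smul, norm_coe, Real.norm_of_nonneg hr.le]
      ring
  have hI₁ : Integrable (fun z : R3 => radialExt d' z * φ₁ ‖z‖) :=
    integrable_radialExt_mul hdi' integrableOn_mul_exp_neg_sq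
  have hI₂ : Integrable (fun z : R3 => radialExt (fun x => g' x * dot x y) z * φ₂ ‖z‖) :=
    integrable_radialExt_mul hgy integrableOn_pow_three_mul_exp_neg_sq
  have hΨ : Integrable Ψ := by
    refine integrable_radialExt_mul (φ := fun r => Real.exp (-r ^ 2)) hgi' ?_
    have h := integrableOn_rpow_mul_exp_neg_rpow (p := 2) (s := 2) (by norm_num) (by norm_num)
    refine h.congr_fun (fun r (hr : 0 < r) => ?_) measurableSet_Ioi
    simp only [Real.rpow_two]
  have hΨ' : Integrable Ψ' := hI₁.sub hI₂
  have key := integral_bilinear_hasLineDerivAt_right_eq_neg_left_of_integrable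
    (μ := (volume : Measure R3)) (f := fun _ : R3 => (1 : ℝ)) (f' := fun _ => 0) (g := Ψ) (g' := Ψ')
    (v := (y : R3)) (B := ContinuousLinearMap.mul ℝ ℝ) (by simp)
    (by simpa only [ContinuousLinearMap.mul_apply', one_mul] using hΨ')
    (by simpa using hΨ)
    (fun z _ => by simpa [HasLineDerivAt] using hasDerivAt_const (0 : ℝ) (1 : ℝ))
    (fun z _ => hderiv z)
  simp only [ContinuousLinearMap.mul_apply', one_mul, zero_mul, integral_zero, neg_zero] at key
  simp only [Ψ'] at key
  rw [integral_sub hI₁ hI₂, integral_radialExt_mul, integral_radialExt_mul,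
    integral_mul_exp_neg_sq, integral_pow_three_mul_exp_neg_sq, integral_congr_ae hd'] at key
  have hgy' : ∫ x, g' x * dot x y ∂area = ∫ x, g x * dot x y ∂area :=
    integral_congr_ae (hg'.mono fun x hx => by simp only [hx])
  rw [hgy'] at key
  linarith

/-! ### Zonal functions -/

lemma radialExt_dot (y : S2) :
    radialExt (fun x => dot x y) = fun z : R3 => inner ℝ z (y : R3) / ‖z‖ := by
  funext z
  by_cases hz : z = 0
  · simp [hz, radialExt_zero]
  · rw [← norm_mul_radialExt_dot, mul_div_cancel_left₀ _ (norm_ne_zero_iff.2 hz)]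

lemma radialExt_comp (F : ℝ → ℝ) (g : S2 → ℝ) {z : R3} (hz : z ≠ 0) :
    radialExt (fun x => F (g x)) z = F (radialExt g z) := by
  simp [radialExt, dif_pos hz]

lemma exists_radialExt_eq (f : S2 → ℝ) {z : R3} (hz : z ≠ 0) : ∃ x, radialExt f z = f x := by
  obtain ⟨r, hr, x, rfl⟩ := exists_smul_coe hz
  exact ⟨x, by rw [radialExt_smul _ hr, radialExt_coe]⟩

lemma hasDerivAt_line (z w : R3) : HasDerivAt (fun t : ℝ => z + t • w) w 0 := by
  simpa using ((hasDerivAt_id (0 : ℝ)).smul_const w).const_add z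

lemma hasDerivAt_norm_line {z : R3} (hz : z ≠ 0) (w : R3) :
    HasDerivAt (fun t : ℝ => ‖z + t • w‖) (inner ℝ z w / ‖z‖) 0 := by
  have h := (hasDerivAt_line z w).norm_sq.sqrt (by simpa using hz)
  simp only [Real.sqrt_sq (norm_nonneg _), zero_smul, add_zero] at h
  refine h.congr_deriv ?_
  rw [mul_div_mul_left _ _ two_ne_zero]

lemma hasDerivAt_inner_line (z w v : R3) :
    HasDerivAt (fun t : ℝ => inner ℝ (z + t • w) v) (inner ℝ w v) 0 := by
  simpa using (hasDerivAt_line z w).inner ℝ (hasDerivAt_const (0 : ℝ) v)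

lemma hasLineDerivAt_radialExt_dot (y : S2) {z : R3} (hz : z ≠ 0) (w : R3) :
    HasLineDerivAt ℝ (radialExt fun x => dot x y)
      (inner ℝ w (y : R3) / ‖z‖ - inner ℝ z (y : R3) * inner ℝ z w / ‖z‖ ^ 3) z w := by
  have hz' : ‖z‖ ≠ 0 := norm_ne_zero_iff.2 hz
  rw [radialExt_dot]
  unfold HasLineDerivAt
  refine ((hasDerivAt_inner_line z w y).div (hasDerivAt_norm_line hz w)
    (by simpa using hz)).congr_deriv ?_
  simp only [zero_smul, add_zero]
  field_simp

lemma eventually_line_ne_zero {z : R3} (hz : z ≠ 0) (w : R3) :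
    ∀ᶠ t : ℝ in 𝓝 0, z + t • w ≠ 0 :=
  (hasDerivAt_line z w).continuousAt.eventually_ne (by simpa using hz)

lemma hasLineDerivAt_radialExt_comp {F : ℝ → ℝ} {F' d : ℝ} {g : S2 → ℝ} {z w : R3} (hz : z ≠ 0)
    (hF : HasDerivAt F F' (radialExt g z)) (hg : HasLineDerivAt ℝ (radialExt g) d z w) :
    HasLineDerivAt ℝ (radialExt fun x => F (g x)) (F' * d) z w := by
  unfold HasLineDerivAt at *
  have h := HasDerivAt.comp (h₂ := F) (0 : ℝ) (by simpa using hF) hg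
  exact h.congr_of_eventuallyEq ((eventually_line_ne_zero hz w).mono fun t ht =>
    radialExt_comp F g ht)

/-- The derivative of a zonal function `F ⟨x, y⟩` at a point of the sphere. -/
lemma hasLineDerivAt_zonal (y x : S2) (w : R3) {F : ℝ → ℝ} {F' : ℝ}
    (hF : HasDerivAt F F' (dot x y)) :
    HasLineDerivAt ℝ (radialExt fun x => F (dot x y))
      (F' * (inner ℝ w (y : R3) - dot x y * inner ℝ (x : R3) w)) (x : R3) w := by
  have h := hasLineDerivAt_radialExt_comp (g := fun x => dot x y) (coe_ne_zero x)
    (by rwa [radialExt_coe]) (hasLineDerivAt_radialExt_dot y (coe_ne_zero x) w)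
  simpa [dot] using h

lemma inner_self_sub (y x : S2) :
    inner ℝ (y : R3) (y : R3) - dot x y * inner ℝ (x : R3) (y : R3) = 1 - dot x y ^ 2 := by
  rw [real_inner_self_eq_norm_sq, norm_coe, dot]; ring

/-- The divergence theorem for a zonal function: `∫ (1 - s²) F'(s) - 2 s F(s) = 0`, `s = ⟨x, y⟩`. -/
lemma integral_zonal_field (y : S2) {F F' : ℝ → ℝ}
    (hF : ∀ s, -1 < s → s < 1 → HasDerivAt F (F' s) s)
    (hi : Integrable (fun x => F (dot x y)) area)
    (hi' : Integrable (fun x => F' (dot x y) * (1 - dot x y ^ 2)) area) :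
    ∫ x, F' (dot x y) * (1 - dot x y ^ 2) ∂area = 2 * ∫ x, F (dot x y) * dot x y ∂area := by
  refine integral_conformal_field y (fun x h1 h2 => ?_) hi hi'
  rw [← inner_self_sub]
  exact hasLineDerivAt_zonal y x y (hF _ (neg_one_lt_dot h2) (dot_lt_one h1))

lemma abs_dot_le_one (x y : S2) : |dot x y| ≤ 1 := abs_le.2 ⟨neg_one_le_dot x y, dot_le_one x y⟩

lemma contDiffAt_radialExt_dot (y : S2) {z : R3} (hz : z ≠ 0) {n : ℕ∞ω} :
    ContDiffAt ℝ n (radialExt fun x => dot x y) z := by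
  rw [radialExt_dot]
  exact (contDiffAt_id.inner ℝ contDiffAt_const).div (contDiffAt_norm ℝ hz) (norm_ne_zero_iff.2 hz)

/-- The Laplacian of a zonal function: `Δ F(s) = (1 - s²) F''(s) - 2 s F'(s)`, `s = ⟨x, y⟩`. -/
theorem lap_zonal (y x : S2) {F F' F'' : ℝ → ℝ}
    (hF : ∀ s, |s| ≤ 1 → HasDerivAt F (F' s) s) (hF' : ∀ s, |s| ≤ 1 → HasDerivAt F' (F'' s) s)
    (hc : ∀ s, |s| ≤ 1 → ContDiffAt ℝ 2 F s) :
    lap (fun x => F (dot x y)) x =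
      F'' (dot x y) * (1 - dot x y ^ 2) - 2 * dot x y * F' (dot x y) := by
  set f := radialExt fun x => F (dot x y) with hf
  have hbound : ∀ z : R3, z ≠ 0 → |radialExt (fun x => dot x y) z| ≤ 1 := fun z hz => by
    obtain ⟨x', h⟩ := exists_radialExt_eq (fun x => dot x y) hz
    rw [h]; exact abs_dot_le_one x' y
  have hfe : ∀ z : R3, z ≠ 0 → f =ᶠ[𝓝 z] fun z => F (radialExt (fun x => dot x y) z) :=
    fun z hz => by
      filter_upwards [isOpen_ne.mem_nhds hz] with z' hz' using radialExt_comp F _ hz'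
  have hfc : ∀ z : R3, z ≠ 0 → ContDiffAt ℝ 2 f z := fun z hz =>
    ((hc _ (hbound z hz)).comp z (contDiffAt_radialExt_dot y hz)).congr_of_eventuallyEq (hfe z hz)
  have hfd : ∀ (z : R3), z ≠ 0 → ∀ w, fderiv ℝ f z w = F' (radialExt (fun x => dot x y) z) *
      (inner ℝ w (y : R3) / ‖z‖ - inner ℝ z (y : R3) * inner ℝ z w / ‖z‖ ^ 3) := by
    intro z hz w
    rw [← ((hfc z hz).differentiableAt (by norm_num)).lineDeriv_eq_fderiv]
    exact (hasLineDerivAt_radialExt_comp hz (hF _ (hbound z hz))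
      (hasLineDerivAt_radialExt_dot y hz w)).lineDeriv
  have hx := coe_ne_zero x
  have second : ∀ w : R3, ‖w‖ = 1 → iteratedFDeriv ℝ 2 f x ![w, w] =
      F'' (dot x y) * (inner ℝ w (y : R3) - dot x y * inner ℝ (x : R3) w) ^ 2
      + F' (dot x y) * (- 2 * (inner ℝ w (y : R3) * inner ℝ (x : R3) w) - dot x y
        + 3 * dot x y * inner ℝ (x : R3) w ^ 2) := by
    intro w hw
    have hd : DifferentiableAt ℝ (fderiv ℝ f) (x : R3) :=
      ((hfc x hx).fderiv_right (m := 1) (by norm_num)).differentiableAt (by norm_num)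
    rw [iteratedFDeriv_two_apply]
    simp only [Matrix.cons_val_zero, Matrix.cons_val_one]
    have h1 : fderiv ℝ (fderiv ℝ f) (x : R3) w w =
        fderiv ℝ (fun z => fderiv ℝ f z w) (x : R3) w := by
      rw [fderiv_clm_apply hd (differentiableAt_const w)]; simp
    have h2 : DifferentiableAt ℝ (fun z => fderiv ℝ f z w) (x : R3) :=
      hd.clm_apply (differentiableAt_const w)
    rw [h1, ← h2.lineDeriv_eq_fderiv]
    apply HasLineDerivAt.lineDeriv
    unfold HasLineDerivAt
    have hN := hasLineDerivAt_radialExt_dot y hx w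
    unfold HasLineDerivAt at hN
    have hF1 := HasDerivAt.comp (h₂ := F') (0 : ℝ)
      (by simpa using hF' (dot x y) (abs_dot_le_one x y)) hN
    have hn := hasDerivAt_norm_line hx w
    have ha := (hasDerivAt_const (0 : ℝ) (inner ℝ w (y : R3))).fun_div hn (by simp)
    have hxx : HasDerivAt (fun t : ℝ => inner ℝ ((x : R3) + t • w) w) (inner ℝ w w) 0 :=
      hasDerivAt_inner_line _ _ _
    have hb := ((hasDerivAt_inner_line (x : R3) w y).fun_mul hxx).fun_div (hn.fun_pow 3) (by simp)
    have hall := hF1.fun_mul (ha.fun_sub hb)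
    refine (hall.congr_of_eventuallyEq ((eventually_line_ne_zero hx w).mono fun t ht =>
      hfd _ ht w)).congr_deriv ?_
    simp [hw, dot]
    ring
  have hlap : lap (fun x => F (dot x y)) x =
      ∑ i, iteratedFDeriv ℝ 2 f x ![EuclideanSpace.basisFun (Fin 3) ℝ i,
        EuclideanSpace.basisFun (Fin 3) ℝ i] := by
    rw [lap, InnerProductSpace.laplacian_eq_iteratedFDeriv_orthonormalBasis _
      (EuclideanSpace.basisFun (Fin 3) ℝ)]
  rw [hlap, Finset.sum_congr rfl fun i _ => second _ (by simp)]
  have hxn : (x : R3) 0 ^ 2 + (x : R3) 1 ^ 2 + (x : R3) 2 ^ 2 = 1 := by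
    have := norm_coe x
    rw [EuclideanSpace.norm_eq, Real.sqrt_eq_one] at this
    simpa [Fin.sum_univ_three] using this
  have hyn : (y : R3) 0 ^ 2 + (y : R3) 1 ^ 2 + (y : R3) 2 ^ 2 = 1 := by
    have := norm_coe y
    rw [EuclideanSpace.norm_eq, Real.sqrt_eq_one] at this
    simpa [Fin.sum_univ_three] using this
  have hxy : (x : R3) 0 * (y : R3) 0 + (x : R3) 1 * (y : R3) 1 + (x : R3) 2 * (y : R3) 2 =
      dot x y := by
    simp [dot, PiLp.inner_apply, Fin.sum_univ_three, mul_comm]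
  simp only [Fin.sum_univ_three, EuclideanSpace.basisFun_apply, EuclideanSpace.inner_single_left,
    EuclideanSpace.inner_single_right, map_one, one_mul, conj_trivial]
  generalize dot x y = s at *
  linear_combination F'' s * (hyn - 2 * s * hxy + s ^ 2 * hxn) + F' s * (-2 * hxy + 3 * s * hxn)

/-! ### Zonal kernels -/

lemma area_real_univ : area.real univ = 4 * Real.pi := by
  rw [area, Measure.toSphere_real_apply_univ, measureReal_def, EuclideanSpace.volume_ball_fin_three]
  have := Real.pi_pos
  simp only [ENNReal.ofReal_one, one_pow, one_mul, finrank_euclideanSpace, Fintype.card_fin,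
    ENNReal.toReal_ofReal (show 0 ≤ Real.pi * 4 / 3 by positivity)]
  push_cast
  ring

lemma integrable_of_continuous {f : S2 → ℝ} (hf : Continuous f) : Integrable f area :=
  hf.integrable_of_hasCompactSupport (HasCompactSupport.of_compactSpace f)

/-- Integrals of zonal functions do not depend on the pole. -/
lemma integral_zonal_eq (F : ℝ → ℝ) (y y' : S2) :
    ∫ x, F (dot x y) ∂area = ∫ x, F (dot x y') ∂area := by
  -- a reflection exchanges the two poles
  set T : R3 ≃ₗᵢ[ℝ] R3 := (Submodule.span ℝ {(y : R3) - (y' : R3)})ᗮ.reflection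
  have hT : T (y : R3) = (y' : R3) := Submodule.reflection_sub (by simp)
  have h := T.measurePreserving.integral_comp T.toHomeomorph.measurableEmbedding
    fun z : R3 => radialExt (fun x => F (dot x y')) z * (‖z‖⁻¹ * Real.exp (-‖z‖ ^ 2))
  have e : ∀ z : R3, radialExt (fun x => F (dot x y')) (T z) =
      radialExt (fun x => F (dot x y)) z := by
    intro z
    by_cases hz : z = 0
    · simp [hz, radialExt_zero]
    · rw [radialExt_comp F _ (by simpa using hz), radialExt_comp F _ hz, radialExt_dot,
        radialExt_dot]
      simp only [T.norm_map, ← hT, T.inner_map_map]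
  simp only [T.norm_map, e] at h
  rw [integral_radialExt_mul _ fun r => r⁻¹ * Real.exp (-r ^ 2),
    integral_radialExt_mul _ fun r => r⁻¹ * Real.exp (-r ^ 2), integral_mul_exp_neg_sq] at h
  linarith

lemma sub_dot_pos {a : ℝ} (ha : 1 < a) (x y : S2) : 0 < a - dot x y := by
  linarith [dot_le_one x y]

/-- The mass of the Poisson-type kernel `(a² - 1) / (a - ⟨x, y⟩)²` is `4 π`. -/
lemma integral_poisson {a : ℝ} (ha : 1 < a) (y : S2) :
    ∫ x, (a ^ 2 - 1) / (a - dot x y) ^ 2 ∂area = 4 * Real.pi := by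
  have hne : ∀ x : S2, a - dot x y ≠ 0 := fun x => (sub_dot_pos ha x y).ne'
  have hc : Continuous fun x : S2 => (a - dot x y)⁻¹ := by
    refine Continuous.inv₀ (by fun_prop) hne
  have h := integral_zonal_field y (F := fun s => (a - s)⁻¹) (F' := fun s => ((a - s)⁻¹) ^ 2)
    (fun s _ hs => by
      have := (((hasDerivAt_id s).const_sub a)).fun_inv (show a - s ≠ 0 by linarith)
      refine this.congr_deriv ?_
      simp [div_eq_mul_inv])
    (integrable_of_continuous hc)
    (integrable_of_continuous (by fun_prop))
  have h2 : ∫ x, ((a - dot x y)⁻¹ ^ 2 * (1 - dot x y ^ 2)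
      - 2 * ((a - dot x y)⁻¹ * dot x y)) ∂area = 0 := by
    rw [integral_sub (integrable_of_continuous (by fun_prop))
      (integrable_of_continuous (by fun_prop)), integral_const_mul, h, sub_self]
  have h3 : ∀ x, (a - dot x y)⁻¹ ^ 2 * (1 - dot x y ^ 2) - 2 * ((a - dot x y)⁻¹ * dot x y)
      = 1 - (a ^ 2 - 1) / (a - dot x y) ^ 2 := fun x => by
    have := hne x
    field_simp
    ring
  simp only [h3] at h2
  have h4 : Continuous fun x : S2 => (a ^ 2 - 1) / (a - dot x y) ^ 2 := by
    simp only [div_eq_mul_inv, ← inv_pow]; fun_prop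
  rw [integral_sub (integrable_const _) (integrable_of_continuous h4)] at h2
  simp only [integral_const, area_real_univ, smul_eq_mul, mul_one] at h2
  linarith

/-- The zonal identity for `F(s) = (a - s)^(-γ)` bounds the integral of `(a - s)^(-γ)` by that of
`(a - s)^(1 - γ)`, uniformly as `a` approaches `1`. -/
lemma integral_sub_dot_rpow_le {γ a : ℝ} (h0 : 0 < γ) (h1 : γ < 1) (ha : 1 < a) (ha2 : a ≤ 2)
    (y : S2) :
    ∫ x, (a - dot x y) ^ (-γ) ∂area ≤ 12 * Real.pi * (2 - γ) / (2 - 2 * γ) := by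
  have hpos : ∀ x : S2, 0 < a - dot x y := fun x => sub_dot_pos ha x y
  have hc : ∀ p : ℝ, Continuous fun x : S2 => (a - dot x y) ^ p := fun p =>
    Continuous.rpow_const (by fun_prop) fun x => .inl (hpos x).ne'
  have hc1 := hc (-γ)
  have hc2 := hc (-γ - 1)
  have h := integral_zonal_field y (F := fun s => (a - s) ^ (-γ))
    (F' := fun s => γ * (a - s) ^ (-γ - 1))
    (fun s _ hs => by
      have := (((hasDerivAt_id s).const_sub a)).rpow_const (p := -γ)
        (.inl (show a - s ≠ 0 by linarith))
      refine this.congr_deriv ?_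
      simp)
    (integrable_of_continuous (hc _))
    (integrable_of_continuous (by fun_prop))
  have hle : ∫ x, (γ * (a - dot x y) ^ (-γ - 1) * (1 - dot x y ^ 2)
        - 2 * ((a - dot x y) ^ (-γ) * dot x y)) ∂area ≤
      ∫ x, ((2 - γ) * 3 - (2 - 2 * γ) * (a - dot x y) ^ (-γ)) ∂area := by
    refine integral_mono (integrable_of_continuous (by fun_prop))
      (integrable_of_continuous (by fun_prop)) fun x => ?_
    have hx := hpos x
    have hs := dot_le_one x y
    have hs' := neg_one_le_dot x y
    simp only
    rw [Real.rpow_sub_one hx.ne']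
    set t := (a - dot x y) ^ (-γ) with ht
    have htpos : 0 < t := Real.rpow_pos_of_pos hx _
    have htt : t * (a - dot x y) ≤ 3 := by
      rw [ht, ← Real.rpow_add_one hx.ne']
      calc (a - dot x y) ^ (-γ + 1) ≤ 3 ^ (-γ + 1) :=
            Real.rpow_le_rpow hx.le (by linarith) (by linarith)
        _ ≤ 3 ^ (1 : ℝ) := Real.rpow_le_rpow_of_exponent_le (by norm_num) (by linarith)
        _ = 3 := Real.rpow_one 3
    generalize dot x y = s at *
    have e1 : γ * (t / (a - s)) * (1 - s ^ 2) ≤ γ * t * (1 + s) := by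
      have : (1 - s) / (a - s) ≤ 1 := by rw [div_le_one hx]; linarith
      calc γ * (t / (a - s)) * (1 - s ^ 2) = γ * t * (1 + s) * ((1 - s) / (a - s)) := by
            field_simp; ring
        _ ≤ γ * t * (1 + s) * 1 := by
            refine mul_le_mul_of_nonneg_left this ?_
            have : 0 ≤ 1 + s := by linarith
            positivity
        _ = _ := mul_one _
    have e2 : t * (1 - s) ≤ t * (a - s) := mul_le_mul_of_nonneg_left (by linarith) htpos.le
    have e3 : (2 - γ) * (t * (1 - s)) ≤ (2 - γ) * 3 :=
      mul_le_mul_of_nonneg_left (e2.trans htt) (by linarith)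
    linarith
  rw [integral_sub (integrable_of_continuous (by fun_prop))
      (integrable_of_continuous (by fun_prop)), integral_const_mul, h, sub_self,
    integral_sub (integrable_const _) (integrable_of_continuous (by fun_prop)),
    integral_const_mul (2 - 2 * γ)] at hle
  simp only [integral_const, area_real_univ, smul_eq_mul] at hle
  rw [le_div_iff₀ (by linarith)]
  linarith

/-- The Riesz kernels `(1 - ⟨x, y⟩)^(-γ)`, `γ < 1`, are integrable uniformly in `y`. -/
theorem exists_lintegral_rpow_le {γ : ℝ} (h0 : 0 < γ) (h1 : γ < 1) :
    ∃ C : ℝ, 0 ≤ C ∧ ∀ y : S2,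
      ∫⁻ x, ENNReal.ofReal ((1 - dot x y) ^ (-γ)) ∂area ≤ ENNReal.ofReal C := by
  refine ⟨12 * Real.pi * (2 - γ) / (2 - 2 * γ), ?_, fun y => ?_⟩
  · have : 0 < 2 - γ := by linarith
    have : 0 < 2 - 2 * γ := by linarith
    have := Real.pi_pos
    positivity
  obtain ⟨a, -, ha, hat⟩ := exists_seq_strictAnti_tendsto' (show (1 : ℝ) < 2 by norm_num)
  have hlim : ∀ᵐ x ∂area, ENNReal.ofReal ((1 - dot x y) ^ (-γ)) =
      liminf (fun n => ENNReal.ofReal ((a n - dot x y) ^ (-γ))) atTop := by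
    filter_upwards [ae_ne_poles y] with x hx
    refine (Tendsto.liminf_eq ?_).symm
    refine ENNReal.tendsto_ofReal (Tendsto.rpow_const (hat.sub_const _) (.inl ?_))
    linarith [dot_lt_one hx.1]
  rw [lintegral_congr_ae hlim]
  refine (lintegral_liminf_le' fun n => ?_).trans ?_
  · exact (((continuous_dot_left y).measurable.const_sub _).pow_const _).ennreal_ofReal.aemeasurable
  refine liminf_le_of_frequently_le' (.of_forall fun n => ?_)
  have hpos : ∀ x : S2, 0 < a n - dot x y := fun x => sub_dot_pos (ha n).1 x y
  rw [← ofReal_integral_eq_lintegral_ofReal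
    (integrable_of_continuous (Continuous.rpow_const (by fun_prop) fun x => .inl (hpos x).ne'))
    (.of_forall fun x => (Real.rpow_pos_of_pos (hpos x) _).le)]
  exact ENNReal.ofReal_le_ofReal (integral_sub_dot_rpow_le h0 h1 (ha n).1 (ha n).2.le y)

lemma abs_log_le {t : ℝ} (h0 : 0 ≤ t) (h3 : t ≤ 3) : |Real.log t| ≤ 2 * t ^ (-(1 / 2) : ℝ) + 2 := by
  have hp : 0 ≤ t ^ (-(1 / 2) : ℝ) := Real.rpow_nonneg h0 _
  rcases h0.eq_or_lt with rfl | h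
  · simp
  rcases le_total t 1 with h1 | h1
  · have := Real.abs_log_mul_self_rpow_lt t (1 / 2) h h1 (by norm_num)
    rw [abs_mul, abs_of_pos (Real.rpow_pos_of_pos h _)] at this
    rw [Real.rpow_neg h0]
    have h2 := Real.rpow_pos_of_pos h (1 / 2)
    have : |Real.log t| ≤ 2 * (t ^ (1 / 2 : ℝ))⁻¹ := by
      rw [← div_eq_mul_inv, le_div_iff₀ h2]; linarith
    linarith
  · rw [abs_of_nonneg (Real.log_nonneg h1)]
    linarith [Real.log_le_sub_one_of_pos h]

lemma measurable_log_kernel (a : ℝ) :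
    Measurable fun p : S2 × S2 => Real.log (a - dot p.1 p.2) :=
  Real.measurable_log.comp (continuous_dot.measurable.const_sub a)

/-- The logarithmic kernel is integrable uniformly in the pole. -/
theorem exists_lintegral_log_le : ∃ C : ℝ, 0 ≤ C ∧ ∀ y : S2,
    ∫⁻ x, ENNReal.ofReal |Real.log (1 - dot x y)| ∂area ≤ ENNReal.ofReal C := by
  obtain ⟨C, hC, h⟩ := exists_lintegral_rpow_le (γ := 1 / 2) (by norm_num) (by norm_num)
  refine ⟨2 * C + 2 * (4 * Real.pi), by have := Real.pi_pos; positivity, fun y => ?_⟩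
  have hp : ∀ x : S2, 0 ≤ 1 - dot x y := fun x => by linarith [dot_le_one x y]
  calc
    ∫⁻ x, ENNReal.ofReal |Real.log (1 - dot x y)| ∂area
      ≤ ∫⁻ x, (ENNReal.ofReal 2 * ENNReal.ofReal ((1 - dot x y) ^ (-(1 / 2) : ℝ))
        + ENNReal.ofReal 2) ∂area := by
        refine lintegral_mono fun x => ?_
        rw [← ENNReal.ofReal_mul zero_le_two, ← ENNReal.ofReal_add
          (mul_nonneg zero_le_two (Real.rpow_nonneg (hp x) _)) zero_le_two]
        exact ENNReal.ofReal_le_ofReal (abs_log_le (hp x) (by linarith [neg_one_le_dot x y]))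
    _ = ENNReal.ofReal 2 * ∫⁻ x, ENNReal.ofReal ((1 - dot x y) ^ (-(1 / 2) : ℝ)) ∂area
        + ENNReal.ofReal 2 * area univ := by
        rw [lintegral_add_right _ measurable_const, lintegral_const_mul' _ _ ENNReal.ofReal_ne_top,
          lintegral_const]
    _ ≤ ENNReal.ofReal 2 * ENNReal.ofReal C + ENNReal.ofReal 2 * ENNReal.ofReal (4 * Real.pi) := by
        gcongr
        · exact h y
        · rw [← area_real_univ, ofReal_measureReal]
    _ = _ := by
        rw [← ENNReal.ofReal_mul zero_le_two, ← ENNReal.ofReal_mul zero_le_two,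
          ← ENNReal.ofReal_add (by positivity) (by have := Real.pi_pos; positivity)]

/-! ### Representation of distributional solutions by logarithmic potentials -/

lemma isSmooth_log_sub_dot {a : ℝ} (ha : 1 < a) (y : S2) :
    IsSmooth fun x => Real.log (a - dot x y) := by
  intro x
  have : Fact (Module.finrank ℝ R3 = 2 + 1) := ⟨by simp⟩
  have h : ContDiffAt ℝ ∞ (fun z : R3 => Real.log (a - inner ℝ z (y : R3))) (x : R3) := by
    refine ContDiffAt.log (contDiffAt_const.sub (contDiffAt_id.inner ℝ contDiffAt_const)) ?_
    exact (sub_dot_pos ha x y).ne'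
  exact h.contMDiffAt.comp x ((contMDiff_coe_sphere (E := R3) (n := 2)).contMDiffAt)

lemma lap_log_sub_dot {a : ℝ} (ha : 1 < a) (x y : S2) :
    lap (fun x => Real.log (a - dot x y)) x = (a ^ 2 - 1) / (a - dot x y) ^ 2 - 1 := by
  have hne : ∀ s : ℝ, |s| ≤ 1 → a - s ≠ 0 := fun s hs => by
    have := (abs_le.1 hs).2
    linarith
  have h := lap_zonal y x (F := fun s => Real.log (a - s)) (F' := fun s => -(a - s)⁻¹)
    (F'' := fun s => -((a - s) ^ 2)⁻¹)
    (fun s hs => (((hasDerivAt_id s).const_sub a).log (hne s hs)).congr_deriv (by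
      simp [div_eq_mul_inv]))
    (fun s hs => (((hasDerivAt_id s).const_sub a).fun_inv (hne s hs)).fun_neg.congr_deriv (by
      simp))
    (fun s hs => (contDiffAt_const.sub contDiffAt_id).log (hne s hs))
  rw [h]
  have := (sub_dot_pos ha x y).ne'
  field_simp
  ring

/-- `w` solves `-Δ w = μ - μ(S²) / |S²|` on `S²` in the sense of distributions. -/
def HasLaplacian (w : S2 → ℝ) (μ : Measure S2) : Prop :=
  ∀ φ : S2 → ℝ, IsSmooth φ →
    -∫ x, w x * lap φ x ∂area = ∫ x, φ x ∂μ - μ.real univ / (4 * Real.pi) * ∫ x, φ x ∂area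

/-- The Poisson means of a distributional solution, from testing with a regularized logarithm. -/
lemma HasLaplacian.integral_poisson {w : S2 → ℝ} {μ : Measure S2} (h : HasLaplacian w μ)
    (hw : Integrable w area) {a : ℝ} (ha : 1 < a) (y p : S2) :
    ∫ x, (a ^ 2 - 1) / (a - dot x y) ^ 2 * w x ∂area = ∫ x, w x ∂area
      + μ.real univ / (4 * Real.pi) * ∫ x, Real.log (a - dot x p) ∂area
      - ∫ x, Real.log (a - dot x y) ∂μ := by
  have h1 := h _ (isSmooth_log_sub_dot ha y)
  rw [integral_zonal_eq (fun s => Real.log (a - s)) y p] at h1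
  simp only [lap_log_sub_dot ha] at h1
  have hc : Continuous fun x : S2 => (a ^ 2 - 1) / (a - dot x y) ^ 2 :=
    Continuous.div (by fun_prop) (by fun_prop) fun x => pow_ne_zero _ (sub_dot_pos ha x y).ne'
  obtain ⟨C, hC⟩ := (isCompact_univ (X := S2)).exists_bound_of_continuousOn hc.continuousOn
  have hi : Integrable (fun x => (a ^ 2 - 1) / (a - dot x y) ^ 2 * w x) area :=
    hw.bdd_mul hc.aestronglyMeasurable (.of_forall fun x => hC x (mem_univ x))
  have e : ∀ x, w x * ((a ^ 2 - 1) / (a - dot x y) ^ 2 - 1) =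
      (a ^ 2 - 1) / (a - dot x y) ^ 2 * w x - w x := fun x => by ring
  simp only [e] at h1
  rw [integral_sub hi hw] at h1
  linarith

/-- The Poisson means of an integrable function converge at every point of continuity. -/
lemma tendsto_integral_poisson {g : S2 → ℝ} (hg : Integrable g area) {y : S2}
    (hc : ContinuousAt g y) :
    Tendsto (fun a : ℝ => ∫ x, (a ^ 2 - 1) / (a - dot x y) ^ 2 * g x ∂area) (𝓝[>] 1)
      (𝓝 (4 * Real.pi * g y)) := by
  have hpi := Real.pi_pos
  have ha1 : ∀ᶠ a : ℝ in 𝓝[>] 1, 1 < a := self_mem_nhdsWithin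
  have key := tendsto_setIntegral_peak_smul_of_integrableOn_of_tendsto (μ := area) (s := univ)
    (t := univ) (x₀ := y) (g := g) (a := g y) (l := 𝓝[>] (1 : ℝ))
    (φ := fun a x => (4 * Real.pi)⁻¹ * ((a ^ 2 - 1) / (a - dot x y) ^ 2))
    MeasurableSet.univ MeasurableSet.univ le_rfl univ_mem (measure_ne_top _ _) ?_ ?_ ?_ ?_
    hg.integrableOn (by simpa using hc.tendsto)
  · have := key.const_mul (4 * Real.pi)
    refine this.congr fun a => ?_
    rw [Measure.restrict_univ, ← integral_const_mul]
    refine integral_congr_ae (.of_forall fun x => ?_)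
    simp only [smul_eq_mul]
    field_simp
  · filter_upwards [ha1] with a ha x _
    have : 0 ≤ a ^ 2 - 1 := by nlinarith
    positivity
  · intro u hu hyu
    -- off a neighbourhood of the pole the scalar product stays away from `1`
    obtain ⟨δ, hδ, hδu⟩ : ∃ δ > 0, ∀ x ∈ univ \ u, δ ≤ 1 - dot x y := by
      have hK : IsCompact (univ \ u) := isCompact_univ.diff hu
      rcases (univ \ u).eq_empty_or_nonempty with h | h
      · exact ⟨1, one_pos, by simp [h]⟩
      obtain ⟨x₀, hx₀, hmin⟩ := hK.exists_isMinOn h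
        (f := fun x => 1 - dot x y) (by fun_prop)
      refine ⟨1 - dot x₀ y, ?_, fun x hx => hmin hx⟩
      have : x₀ ≠ y := fun h => hx₀.2 (h ▸ hyu)
      linarith [dot_lt_one this]
    rw [Metric.tendstoUniformlyOn_iff]
    intro ε hε
    have hlim : Tendsto (fun a : ℝ => (4 * Real.pi)⁻¹ * ((a ^ 2 - 1) / δ ^ 2)) (𝓝[>] 1) (𝓝 0) := by
      have : Continuous fun a : ℝ => (4 * Real.pi)⁻¹ * ((a ^ 2 - 1) / δ ^ 2) := by fun_prop
      have := this.tendsto 1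
      simp only [one_pow, sub_self, zero_div, mul_zero] at this
      exact this.mono_left nhdsWithin_le_nhds
    filter_upwards [ha1, hlim.eventually (gt_mem_nhds hε)] with a ha hae x hx
    have h1 : 0 ≤ a ^ 2 - 1 := by nlinarith
    have h2 := hδu x hx
    simp only [Pi.zero_apply, dist_zero_left, Real.norm_eq_abs]
    rw [abs_of_nonneg (by positivity)]
    refine lt_of_le_of_lt ?_ hae
    gcongr
    linarith
  · refine tendsto_const_nhds.congr' ?_
    filter_upwards [ha1] with a ha
    rw [Measure.restrict_univ, integral_const_mul, SingularLiouville.integral_poisson ha y,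
      inv_mul_cancel₀ (by positivity)]
  · refine .of_forall fun a => ?_
    have : Measurable fun x : S2 => (4 * Real.pi)⁻¹ * ((a ^ 2 - 1) / (a - dot x y) ^ 2) := by
      have := (continuous_dot_left y).measurable
      fun_prop
    exact this.aestronglyMeasurable

lemma log_one_sub_le_log_sub {a s : ℝ} (hs1 : s < 1) (ha : 1 < a) :
    Real.log (1 - s) ≤ Real.log (a - s) :=
  Real.log_le_log (by linarith) (by linarith)

lemma abs_log_sub_le {a s : ℝ} (hs : -1 ≤ s) (hs1 : s < 1) (ha : 1 < a) (ha2 : a ≤ 2) :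
    |Real.log (a - s)| ≤ |Real.log (1 - s)| + 2 := by
  rcases le_total 1 (a - s) with h | h
  · rw [abs_of_nonneg (Real.log_nonneg h)]
    have := Real.log_le_sub_one_of_pos (show 0 < a - s by linarith)
    have := abs_nonneg (Real.log (1 - s))
    linarith
  · rw [abs_of_nonpos (Real.log_nonpos (by linarith) h),
      abs_of_nonpos (Real.log_nonpos (by linarith) (by linarith))]
    linarith [log_one_sub_le_log_sub hs1 ha]

lemma tendsto_integral_mul_log {α : Type*} [MeasurableSpace α] {ν : Measure α} {s g : α → ℝ}
    (hs : Measurable s) (hs0 : ∀ x, -1 ≤ s x) (hs1 : ∀ᵐ x ∂ν, s x < 1) (hg : Integrable g ν)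
    (hgl : Integrable (fun x => g x * Real.log (1 - s x)) ν) :
    Tendsto (fun a : ℝ => ∫ x, g x * Real.log (a - s x) ∂ν) (𝓝[>] 1)
      (𝓝 (∫ x, g x * Real.log (1 - s x) ∂ν)) := by
  refine tendsto_integral_filter_of_dominated_convergence
    (fun x => |g x * Real.log (1 - s x)| + 2 * |g x|) (.of_forall fun a => ?_) ?_
    (hgl.abs.add (hg.abs.const_mul 2)) ?_
  · exact hg.aestronglyMeasurable.mul
      (Real.measurable_log.comp (hs.const_sub a)).aestronglyMeasurable
  · have h2 : ∀ᶠ a : ℝ in 𝓝[>] 1, a ≤ 2 :=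
      nhdsWithin_le_nhds (Iic_mem_nhds (by norm_num))
    filter_upwards [self_mem_nhdsWithin, h2] with a (ha : 1 < a) ha2
    filter_upwards [hs1] with x hx
    rw [Real.norm_eq_abs, abs_mul, abs_mul]
    have := mul_le_mul_of_nonneg_left (abs_log_sub_le (hs0 x) hx ha ha2) (abs_nonneg (g x))
    linarith
  · filter_upwards [hs1] with x hx
    refine Tendsto.const_mul _ ((Real.continuousAt_log (by linarith)).tendsto.comp ?_)
    exact ((continuous_id.sub continuous_const).tendsto 1).mono_left nhdsWithin_le_nhds

lemma integrable_log_kernel (p : S2) : Integrable (fun x => Real.log (1 - dot x p)) area := by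
  obtain ⟨C, -, hC⟩ := exists_lintegral_log_le
  refine ⟨?_, ?_⟩
  · exact (Real.measurable_log.comp
      ((continuous_dot_left p).measurable.const_sub 1)).aestronglyMeasurable
  · rw [hasFiniteIntegral_iff_norm]
    exact (hC p).trans_lt ENNReal.ofReal_lt_top

lemma integrable_log_kernel_prod (μ : Measure S2) [IsFiniteMeasure μ] :
    Integrable (fun q : S2 × S2 => Real.log (1 - dot q.1 q.2)) (μ.prod area) := by
  obtain ⟨C, -, hC⟩ := exists_lintegral_log_le
  refine ⟨(measurable_log_kernel 1).aestronglyMeasurable, ?_⟩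
  rw [hasFiniteIntegral_iff_norm,
    lintegral_prod _ (measurable_log_kernel 1).norm.ennreal_ofReal.aemeasurable]
  calc ∫⁻ x, ∫⁻ y, ENNReal.ofReal ‖Real.log (1 - dot x y)‖ ∂area ∂μ
      ≤ ∫⁻ _, ENNReal.ofReal C ∂μ := lintegral_mono fun x => by
        simpa only [dot_comm x, Real.norm_eq_abs] using hC x
    _ < ⊤ := by
        rw [lintegral_const]
        exact ENNReal.mul_lt_top ENNReal.ofReal_lt_top (measure_lt_top _ _)

lemma ae_prod_dot_lt_one (μ : Measure S2) [IsFiniteMeasure μ] :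
    ∀ᵐ q ∂(μ.prod area), dot q.1 q.2 < 1 := by
  have hm : MeasurableSet {q : S2 × S2 | ¬ dot q.1 q.2 < 1} :=
    (measurableSet_lt continuous_dot.measurable measurable_const).compl
  rw [ae_iff, Measure.measure_prod_null hm]
  refine .of_forall fun x => ?_
  refine measure_mono_null (fun y hy => ?_) (measure_singleton x)
  by_contra h
  exact hy (dot_lt_one (Ne.symm h))

/-- The Poisson means of a distributional solution, tested against a continuous function. -/
lemma HasLaplacian.integral_poisson_mul {w : S2 → ℝ} {μ : Measure S2} [IsFiniteMeasure μ]
    (h : HasLaplacian w μ) (hw : Integrable w area) {ψ : S2 → ℝ} (hψc : Continuous ψ) {a : ℝ}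
    (ha : 1 < a) (p : S2) :
    ∫ x, w x * ∫ y, (a ^ 2 - 1) / (a - dot y x) ^ 2 * ψ y ∂area ∂area =
      (∫ x, w x ∂area + μ.real univ / (4 * Real.pi) * ∫ x, Real.log (a - dot x p) ∂area)
        * ∫ y, ψ y ∂area - ∫ q, ψ q.2 * Real.log (a - dot q.1 q.2) ∂(μ.prod area) := by
  have hψi := integrable_of_continuous hψc
  have hψ2 : Integrable (fun q : S2 × S2 => ψ q.2) (μ.prod area) := hψi.comp_snd μ
  have hne : ∀ q : S2 × S2, a - dot q.1 q.2 ≠ 0 := fun q => (sub_dot_pos ha q.1 q.2).ne'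
  have hcont : Continuous fun q : S2 × S2 => (a ^ 2 - 1) / (a - dot q.2 q.1) ^ 2 * ψ q.2 := by
    have h1 : Continuous fun q : S2 × S2 => dot q.2 q.1 := continuous_dot.comp continuous_swap
    exact (continuous_const.div ((continuous_const.sub h1).pow 2)
      fun q => pow_ne_zero _ (hne q.swap)).mul (hψc.comp continuous_snd)
  have hlogc : Continuous fun q : S2 × S2 => Real.log (a - dot q.1 q.2) :=
    (continuous_const.sub continuous_dot).log hne
  obtain ⟨D, hD⟩ := (isCompact_univ (X := S2 × S2)).exists_bound_of_continuousOn hcont.continuousOn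
  obtain ⟨D', hD'⟩ :=
    (isCompact_univ (X := S2 × S2)).exists_bound_of_continuousOn hlogc.continuousOn
  have hFi : Integrable (fun q : S2 × S2 => w q.1 *
      ((a ^ 2 - 1) / (a - dot q.2 q.1) ^ 2 * ψ q.2)) (area.prod area) :=
    (hw.comp_fst area).mul_bdd hcont.aestronglyMeasurable (.of_forall fun q => hD q (mem_univ q))
  have hlogi : Integrable (fun q : S2 × S2 => ψ q.2 * Real.log (a - dot q.1 q.2)) (μ.prod area) :=
    hψ2.mul_bdd hlogc.aestronglyMeasurable (.of_forall fun q => hD' q (mem_univ q))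
  have e1 : ∫ x, w x * ∫ y, (a ^ 2 - 1) / (a - dot y x) ^ 2 * ψ y ∂area ∂area =
      ∫ y, ψ y * ∫ x, (a ^ 2 - 1) / (a - dot x y) ^ 2 * w x ∂area ∂area := by
    simp only [← integral_const_mul]
    rw [integral_integral_swap (f := fun x y =>
      w x * ((a ^ 2 - 1) / (a - dot y x) ^ 2 * ψ y)) hFi]
    refine integral_congr_ae (.of_forall fun y => integral_congr_ae (.of_forall fun x => ?_))
    simp only [dot_comm y x]
    ring
  rw [e1]
  simp only [h.integral_poisson hw ha _ p]
  have hi2 : Integrable (fun y => ψ y * ∫ x, Real.log (a - dot x y) ∂μ) area :=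
    hlogi.integral_prod_right.congr (.of_forall fun y => integral_const_mul (ψ y) _)
  rw [integral_prod_symm _ hlogi]
  simp only [integral_const_mul, mul_sub]
  rw [integral_sub (hψi.mul_const _) hi2, integral_mul_const]
  ring

/-- A distributional solution of `-Δ w = μ - μ(S²) / |S²|` is, up to a constant, the logarithmic
potential of `μ`. -/
theorem HasLaplacian.ae_eq {w : S2 → ℝ} {μ : Measure S2} [IsFiniteMeasure μ]
    (h : HasLaplacian w μ) (hw : Integrable w area) :
    ∃ c : ℝ, ∀ᵐ y ∂area, w y = c - (4 * Real.pi)⁻¹ * ∫ x, Real.log (1 - dot x y) ∂μ := by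
  have hpi := Real.pi_pos
  obtain ⟨p⟩ : Nonempty S2 := NormedSpace.sphere_nonempty.2 zero_le_one |>.to_subtype
  set c₀ := ∫ x, w x ∂area + μ.real univ / (4 * Real.pi) * ∫ x, Real.log (1 - dot x p) ∂area
  refine ⟨(4 * Real.pi)⁻¹ * c₀, ?_⟩
  have hK := integrable_log_kernel_prod μ
  have hKi : Integrable (fun y => ∫ x, Real.log (1 - dot x y) ∂μ) area := hK.integral_prod_right
  have hvi : Integrable (fun y => (4 * Real.pi)⁻¹ * c₀ -
      (4 * Real.pi)⁻¹ * ∫ x, Real.log (1 - dot x y) ∂μ) area :=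
    (integrable_const _).sub (hKi.const_mul _)
  -- both sides are tested against a smooth `ψ`, and `a → 1` in the identity for Poisson means
  refine ae_eq_of_integral_contMDiff_smul_eq (𝓡 2) hw.locallyIntegrable hvi.locallyIntegrable
    fun ψ hψ _ => ?_
  have hψc : Continuous ψ := hψ.continuous
  have hψi := integrable_of_continuous hψc
  obtain ⟨B, hB⟩ := (isCompact_univ (X := S2)).exists_bound_of_continuousOn hψc.continuousOn
  have hB' : ∀ x, ‖ψ x‖ ≤ B := fun x => hB x (mem_univ x)
  -- the Poisson means of `w`, tested against `ψ`
  have hL : Tendsto (fun a : ℝ => ∫ x, w x * ∫ y, (a ^ 2 - 1) / (a - dot y x) ^ 2 * ψ y ∂area ∂area)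
      (𝓝[>] 1) (𝓝 (∫ x, w x * (4 * Real.pi * ψ x) ∂area)) := by
    refine tendsto_integral_filter_of_dominated_convergence
      (fun x => |w x| * (4 * Real.pi * B)) ?_ ?_ (hw.abs.mul_const _)
      (.of_forall fun x => (tendsto_integral_poisson hψi hψc.continuousAt).const_mul _)
    · refine .of_forall fun a => hw.aestronglyMeasurable.mul ?_
      refine StronglyMeasurable.aestronglyMeasurable ?_
      refine StronglyMeasurable.integral_prod_right (f := fun x y : S2 =>
        (a ^ 2 - 1) / (a - dot y x) ^ 2 * ψ y) ?_
      have h1 : Measurable fun q : S2 × S2 => dot q.2 q.1 :=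
        (continuous_dot.comp continuous_swap).measurable
      have h2 : Measurable fun q : S2 × S2 => ψ q.2 := hψc.measurable.comp measurable_snd
      refine Measurable.stronglyMeasurable ?_
      simp only [Function.uncurry_def]
      fun_prop
    · filter_upwards [self_mem_nhdsWithin] with a (ha : 1 < a)
      refine .of_forall fun x => ?_
      rw [norm_mul, Real.norm_eq_abs]
      refine mul_le_mul_of_nonneg_left ?_ (abs_nonneg _)
      rw [← SingularLiouville.integral_poisson ha x, ← integral_mul_const]
      have h1 : 0 ≤ a ^ 2 - 1 := by nlinarith
      refine norm_integral_le_of_norm_le ?_ (.of_forall fun y => ?_)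
      · refine Integrable.mul_const (integrable_of_continuous ?_) _
        exact Continuous.div (by fun_prop) (by fun_prop)
          fun y => pow_ne_zero _ (sub_dot_pos ha y x).ne'
      · rw [norm_mul, Real.norm_of_nonneg (by positivity)]
        exact mul_le_mul_of_nonneg_left (hB' y) (by positivity)
  have hR1 : Tendsto (fun a : ℝ => ∫ x, (1 : ℝ) * Real.log (a - dot x p) ∂area) (𝓝[>] 1)
      (𝓝 (∫ x, (1 : ℝ) * Real.log (1 - dot x p) ∂area)) :=
    tendsto_integral_mul_log (continuous_dot_left p).measurable (fun x => neg_one_le_dot x p)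
      ((ae_ne_poles p).mono fun x hx => dot_lt_one hx.1) (integrable_const _)
      (by simpa using integrable_log_kernel p)
  simp only [one_mul] at hR1
  have hψ2 : Integrable (fun q : S2 × S2 => ψ q.2) (μ.prod area) := hψi.comp_snd μ
  have hψK : Integrable (fun q : S2 × S2 => ψ q.2 * Real.log (1 - dot q.1 q.2)) (μ.prod area) :=
    hK.bdd_mul hψ2.aestronglyMeasurable (.of_forall fun q => hB' q.2)
  have hR2 : Tendsto (fun a : ℝ => ∫ q, ψ q.2 * Real.log (a - dot q.1 q.2) ∂(μ.prod area)) (𝓝[>] 1)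
      (𝓝 (∫ q, ψ q.2 * Real.log (1 - dot q.1 q.2) ∂(μ.prod area))) :=
    tendsto_integral_mul_log continuous_dot.measurable (fun q => neg_one_le_dot _ _)
      (ae_prod_dot_lt_one μ) hψ2 hψK
  have hR := ((hR1.const_mul (μ.real univ / (4 * Real.pi))).const_add (∫ x, w x ∂area)).mul_const
    (∫ y, ψ y ∂area) |>.sub hR2
  have heq := fun a ha => h.integral_poisson_mul hw hψc (a := a) ha p
  have hlim := tendsto_nhds_unique (hL.congr' (by
    filter_upwards [self_mem_nhdsWithin] with a ha using heq a ha)) hR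
  rw [integral_prod_symm _ hψK] at hlim
  simp only [integral_const_mul] at hlim
  have hi2 : Integrable (fun y => ψ y * ∫ x, Real.log (1 - dot x y) ∂μ) area :=
    hψK.integral_prod_right.congr (.of_forall fun y => integral_const_mul (ψ y) _)
  have e2 : ∫ x, w x * (4 * Real.pi * ψ x) ∂area = 4 * Real.pi * ∫ x, ψ x • w x ∂area := by
    rw [← integral_const_mul]
    exact integral_congr_ae (.of_forall fun x => by simp only [smul_eq_mul]; ring)
  have e3 : ∫ x, ψ x • ((4 * Real.pi)⁻¹ * c₀ -
      (4 * Real.pi)⁻¹ * ∫ z, Real.log (1 - dot z x) ∂μ) ∂area =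
      (4 * Real.pi)⁻¹ * (c₀ * ∫ y, ψ y ∂area
        - ∫ y, ψ y * ∫ x, Real.log (1 - dot x y) ∂μ ∂area) := by
    rw [← integral_const_mul c₀, ← integral_sub (hψi.const_mul _) hi2, ← integral_const_mul]
    exact integral_congr_ae (.of_forall fun x => by simp only [smul_eq_mul]; ring)
  rw [e3, ← hlim, e2]
  field_simp

/-- A Green function is a logarithm, up to a constant: `G_p(y) = c - log (1 - ⟨p, y⟩) / (4 π)`. -/
theorem IsGreenFunction.eq {p : S2} {G : S2 → ℝ} (hG : IsGreenFunction p G) :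
    ∃ c : ℝ, ∀ y, y ≠ p → G y = c - (4 * Real.pi)⁻¹ * Real.log (1 - dot y p) := by
  have hpi := Real.pi_pos
  have h : HasLaplacian G (Measure.dirac p) := fun φ hφ => by
    rw [hG.equation φ hφ, integral_dirac]
    simp
  refine ⟨(4 * Real.pi)⁻¹ * ((4 * Real.pi)⁻¹ * ∫ x, Real.log (1 - dot x p) ∂area), fun y hy => ?_⟩
  have hc : ContinuousAt G y := hG.continuousOn.continuousAt (isOpen_ne.mem_nhds hy)
  have h1 := tendsto_integral_poisson hG.integrable hc
  have hR1 : Tendsto (fun a : ℝ => ∫ x, (1 : ℝ) * Real.log (a - dot x p) ∂area) (𝓝[>] 1)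
      (𝓝 (∫ x, (1 : ℝ) * Real.log (1 - dot x p) ∂area)) :=
    tendsto_integral_mul_log (continuous_dot_left p).measurable (fun x => neg_one_le_dot x p)
      ((ae_ne_poles p).mono fun x hx => dot_lt_one hx.1) (integrable_const _)
      (by simpa using integrable_log_kernel p)
  simp only [one_mul] at hR1
  have hR2 : Tendsto (fun a : ℝ => Real.log (a - dot y p)) (𝓝[>] 1)
      (𝓝 (Real.log (1 - dot y p))) := by
    refine (Real.continuousAt_log (by linarith [dot_lt_one hy])).tendsto.comp ?_
    exact ((continuous_id.sub continuous_const).tendsto 1).mono_left nhdsWithin_le_nhds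
  have hR := (hR1.const_mul (4 * Real.pi)⁻¹).sub hR2
  have hlim := tendsto_nhds_unique (h1.congr' (by
    filter_upwards [self_mem_nhdsWithin] with a (ha : 1 < a)
    rw [h.integral_poisson hG.integrable ha y p, hG.integral_eq_zero, integral_dirac, dot_comm p y]
    simp)) hR
  rw [← mul_right_inj' (show 4 * Real.pi ≠ 0 by positivity), hlim]
  field_simp

/-! ### Integrability estimates -/

lemma rpow_neg_mul_rpow_neg_le {A B α β : ℝ} (hA : 0 ≤ A) (hB : 0 ≤ B) (hα : 0 < α) (hβ : 0 < β) :
    A ^ (-α) * B ^ (-β) ≤ A ^ (-(α + β)) + B ^ (-(α + β)) := by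
  have hA' := Real.rpow_nonneg hA (-(α + β))
  have hB' := Real.rpow_nonneg hB (-(α + β))
  rcases hA.eq_or_lt with rfl | hA0
  · rw [Real.zero_rpow (by linarith), zero_mul]; positivity
  rcases hB.eq_or_lt with rfl | hB0
  · rw [Real.zero_rpow (show -β ≠ 0 by linarith), mul_zero]; positivity
  have eA : A ^ (-α) * A ^ (-β) = A ^ (-(α + β)) := by rw [← Real.rpow_add hA0]; ring_nf
  have eB : B ^ (-α) * B ^ (-β) = B ^ (-(α + β)) := by rw [← Real.rpow_add hB0]; ring_nf
  rcases le_total A B with h | h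
  · have : B ^ (-β) ≤ A ^ (-β) := Real.rpow_le_rpow_of_nonpos hA0 h (by linarith)
    have := mul_le_mul_of_nonneg_left this (Real.rpow_nonneg hA (-α))
    linarith
  · have : A ^ (-α) ≤ B ^ (-α) := Real.rpow_le_rpow_of_nonpos hB0 h (by linarith)
    have := mul_le_mul_of_nonneg_right this (Real.rpow_nonneg hB (-β))
    linarith

lemma one_sub_sq_dot_nonneg (x p : S2) : 0 ≤ 1 - dot x p ^ 2 := by
  nlinarith [dot_le_one x p, neg_one_le_dot x p]

lemma one_sub_sq_dot_pos {x p : S2} (h : x ≠ p ∧ x ≠ -p) : 0 < 1 - dot x p ^ 2 := by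
  nlinarith [dot_lt_one h.1, neg_one_lt_dot h.2]

lemma one_sub_sq_dot_rpow_le {γ : ℝ} (hγ : 0 < γ) (x p : S2) :
    (1 - dot x p ^ 2) ^ (-γ) ≤ (1 - dot x p) ^ (-γ) + (1 - dot x (-p)) ^ (-γ) := by
  rw [dot_neg_right, sub_neg_eq_add]
  have h1 := dot_le_one x p
  have h2 := neg_one_le_dot x p
  generalize dot x p = s at *
  have hA' := Real.rpow_nonneg (show 0 ≤ 1 - s by linarith) (-γ)
  have hB' := Real.rpow_nonneg (show 0 ≤ 1 + s by linarith) (-γ)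
  by_cases h : 1 - s ^ 2 = 0
  · rw [h, Real.zero_rpow (by linarith)]; positivity
  have hs1 : 0 < 1 - s := by
    rcases h1.eq_or_lt with rfl | h'
    · norm_num at h
    · linarith
  have hs2 : 0 < 1 + s := by
    rcases h2.eq_or_lt with rfl | h'
    · norm_num at h
    · linarith
  rcases le_total s 0 with h' | h'
  · have := Real.rpow_le_rpow_of_nonpos hs2 (show 1 + s ≤ 1 - s ^ 2 by nlinarith)
      (show -γ ≤ 0 by linarith)
    linarith
  · have := Real.rpow_le_rpow_of_nonpos hs1 (show 1 - s ≤ 1 - s ^ 2 by nlinarith)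
      (show -γ ≤ 0 by linarith)
    linarith

/-- A Riesz kernel and a power of the distance to the poles `± p` are jointly integrable, uniformly
in the pole of the kernel. -/
theorem exists_lintegral_weight_le (p : S2) {α β : ℝ} (hα : 0 < α) (hβ : 0 < β) (h1 : α + β < 1) :
    ∃ C : ℝ, 0 ≤ C ∧ ∀ y : S2, ∫⁻ x, ENNReal.ofReal
      ((1 - dot x p ^ 2) ^ (-α) * (1 - dot x y) ^ (-β)) ∂area ≤ ENNReal.ofReal C := by
  obtain ⟨C, hC, h⟩ := exists_lintegral_rpow_le (γ := α + β) (by linarith) h1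
  refine ⟨C + C + C, by positivity, fun y => ?_⟩
  have hnn : ∀ x z : S2, 0 ≤ (1 - dot x z) ^ (-(α + β)) := fun x z =>
    Real.rpow_nonneg (by linarith [dot_le_one x z]) _
  have hmeas : ∀ z : S2, Measurable fun x => ENNReal.ofReal ((1 - dot x z) ^ (-(α + β))) := fun z =>
    (((continuous_dot_left z).measurable.const_sub _).pow_const _).ennreal_ofReal
  calc
    _ ≤ ∫⁻ x, (ENNReal.ofReal ((1 - dot x p) ^ (-(α + β)))
        + ENNReal.ofReal ((1 - dot x (-p)) ^ (-(α + β)))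
        + ENNReal.ofReal ((1 - dot x y) ^ (-(α + β)))) ∂area := by
        refine lintegral_mono fun x => ?_
        rw [← ENNReal.ofReal_add (hnn _ _) (hnn _ _),
          ← ENNReal.ofReal_add (add_nonneg (hnn _ _) (hnn _ _)) (hnn _ _)]
        refine ENNReal.ofReal_le_ofReal ?_
        have e1 := rpow_neg_mul_rpow_neg_le (one_sub_sq_dot_nonneg x p)
          (show 0 ≤ 1 - dot x y by linarith [dot_le_one x y]) hα hβ
        have e2 := one_sub_sq_dot_rpow_le (γ := α + β) (by linarith) x p
        linarith
    _ ≤ ENNReal.ofReal C + ENNReal.ofReal C + ENNReal.ofReal C := by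
        rw [lintegral_add_right _ (hmeas _), lintegral_add_right _ (hmeas _)]
        gcongr <;> exact h _
    _ = _ := by
        rw [← ENNReal.ofReal_add hC hC, ← ENNReal.ofReal_add (by linarith) hC]

/-- A kernel with uniformly integrable sections is integrable against `g(x) dx dy`. -/
lemma integrable_mul_kernel {g : S2 → ℝ} {κ : S2 × S2 → ℝ} (hg : Integrable g area)
    (hκ : Measurable κ) {C : ℝ}
    (hC : ∀ x, ∫⁻ y, ENNReal.ofReal |κ (x, y)| ∂area ≤ ENNReal.ofReal C) :
    Integrable (fun q : S2 × S2 => g q.1 * κ q) (area.prod area) := by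
  have hm : AEStronglyMeasurable (fun q : S2 × S2 => g q.1 * κ q) (area.prod area) :=
    hg.aestronglyMeasurable.comp_fst.mul hκ.aestronglyMeasurable
  refine ⟨hm, ?_⟩
  rw [hasFiniteIntegral_iff_norm, lintegral_prod _ hm.norm.aemeasurable.ennreal_ofReal]
  calc ∫⁻ x, ∫⁻ y, ENNReal.ofReal ‖g x * κ (x, y)‖ ∂area ∂area
      ≤ ∫⁻ x, ENNReal.ofReal ‖g x‖ * ENNReal.ofReal C ∂area := by
        refine lintegral_mono fun x => ?_
        simp only [norm_mul, ENNReal.ofReal_mul (norm_nonneg _)]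
        rw [lintegral_const_mul' _ _ ENNReal.ofReal_ne_top]
        gcongr
        exact hC x
    _ < ⊤ := by
        rw [lintegral_mul_const' _ _ ENNReal.ofReal_ne_top]
        exact ENNReal.mul_lt_top ((hasFiniteIntegral_iff_norm _).1 hg.2) ENNReal.ofReal_lt_top

lemma integrable_mul_log_kernel {g : S2 → ℝ} (hg : Integrable g area) :
    Integrable (fun q : S2 × S2 => g q.1 * Real.log (1 - dot q.1 q.2)) (area.prod area) := by
  obtain ⟨C, -, hC⟩ := exists_lintegral_log_le
  refine integrable_mul_kernel hg (measurable_log_kernel 1) (C := C) fun x => ?_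
  simpa only [dot_comm x] using hC x

/-- Jensen's inequality for the exponential of a logarithmic potential of mass `m`. -/
lemma ofReal_exp_potential_le {g : S2 → ℝ} (hg0 : ∀ y, 0 ≤ g y) (hg : Integrable g area)
    {m : ℝ} (hm : m = ∫ y, g y ∂area) (hm0 : 0 < m) {x : S2}
    (hx : Integrable (fun y => g y * Real.log (1 - dot y x)) area) :
    ENNReal.ofReal (Real.exp (-∫ y, g y * Real.log (1 - dot y x) ∂area)) ≤
      ENNReal.ofReal m⁻¹ * ∫⁻ y, ENNReal.ofReal (g y * (1 - dot y x) ^ (-m)) ∂area := by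
  have hmeas : AEStronglyMeasurable (fun y => g y * (1 - dot y x) ^ (-m)) area :=
    hg.aestronglyMeasurable.mul
      (((continuous_dot_left x).measurable.const_sub _).pow_const _).aestronglyMeasurable
  have hnn : ∀ y, 0 ≤ g y * (1 - dot y x) ^ (-m) := fun y =>
    mul_nonneg (hg0 y) (Real.rpow_nonneg (by linarith [dot_le_one y x]) _)
  by_cases hfin : ∫⁻ y, ENNReal.ofReal (g y * (1 - dot y x) ^ (-m)) ∂area = ⊤
  · rw [hfin, ENNReal.mul_top (by simpa using hm0)]; exact le_top
  have hint : Integrable (fun y => g y * (1 - dot y x) ^ (-m)) area :=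
    ⟨hmeas, by
      rw [hasFiniteIntegral_iff_ofReal (.of_forall hnn)]
      exact lt_top_iff_ne_top.2 hfin⟩
  rw [← ofReal_integral_eq_lintegral_ofReal hint (.of_forall hnn),
    ← ENNReal.ofReal_mul (inv_nonneg.2 hm0.le)]
  refine ENNReal.ofReal_le_ofReal ?_
  set t := -∫ y, g y * Real.log (1 - dot y x) ∂area with ht
  -- integrate the tangent line of the exponential at `t`
  have hle : ∫ y, Real.exp t * ((1 - t) * g y - m * (g y * Real.log (1 - dot y x))) ∂area ≤
      ∫ y, g y * (1 - dot y x) ^ (-m) ∂area := by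
    refine integral_mono_ae (((hg.const_mul _).sub (hx.const_mul _)).const_mul _) hint ?_
    filter_upwards [ae_ne_poles x] with y hy
    have hpos : 0 < 1 - dot y x := by linarith [dot_lt_one hy.1]
    have h1 := Real.add_one_le_exp (Real.log (1 - dot y x) * (-m) - t)
    rw [Real.exp_sub, ← Real.rpow_def_of_pos hpos, le_div_iff₀ (Real.exp_pos t)] at h1
    have h2 := mul_le_mul_of_nonneg_left h1 (hg0 y)
    linarith
  rw [integral_const_mul, integral_sub (hg.const_mul _) (hx.const_mul _), integral_const_mul,
    integral_const_mul, ← hm] at hle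
  have e : Real.exp t * ((1 - t) * m - m * ∫ y, g y * Real.log (1 - dot y x) ∂area)
      = m * Real.exp t := by
    rw [show ∫ y, g y * Real.log (1 - dot y x) ∂area = -t by rw [ht, neg_neg]]; ring
  rw [e] at hle
  rwa [inv_mul_eq_div, le_div_iff₀ hm0, mul_comm]

lemma exists_truncation {f : S2 → ℝ} (hf : Integrable f area) {ε : ℝ} (hε : 0 < ε) :
    ∃ N : ℕ, ∫ x, max (f x - N) 0 ∂area < ε := by
  have h : Tendsto (fun N : ℕ => ∫ x, max (f x - N) 0 ∂area) atTop (𝓝 (∫ _, (0 : ℝ) ∂area)) := by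
    refine tendsto_integral_of_dominated_convergence (fun x => |f x|) (fun N => ?_) hf.abs
      (fun N => .of_forall fun x => ?_) (.of_forall fun x => ?_)
    · exact (hf.aestronglyMeasurable.sub aestronglyMeasurable_const).sup aestronglyMeasurable_const
    · rw [Real.norm_of_nonneg (le_max_right _ _)]
      refine max_le ?_ (abs_nonneg _)
      have : (0 : ℝ) ≤ N := N.cast_nonneg
      linarith [le_abs_self (f x)]
    · refine tendsto_const_nhds.congr' ?_
      filter_upwards [tendsto_natCast_atTop_atTop.eventually_ge_atTop (f x)] with N hN
      rw [max_eq_right (by linarith)]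
  rw [integral_zero] at h
  exact (h.eventually (gt_mem_nhds hε)).exists

/-- Exponential integrability of logarithmic potentials: an `L¹` density is the sum of a bounded
density and one of small mass, and the latter is handled by Jensen's inequality. -/
theorem integrable_weight_mul_exp_potential (p : S2) {f : S2 → ℝ} (hf : Integrable f area)
    (hf0 : ∀ y, 0 ≤ f y) {η : ℝ} (hη : 0 < η) (hη1 : η < 1) {b : ℝ} (hb : 0 < b) :
    Integrable (fun x => (1 - dot x p ^ 2) ^ (-(1 - η)) *
      Real.exp (-(b * ∫ y, f y * Real.log (1 - dot y x) ∂area))) area := by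
  have hpi := Real.pi_pos
  obtain ⟨N, hN⟩ := exists_truncation hf (show 0 < η / (4 * b) by positivity)
  -- adding the constant `κ` makes the small mass positive
  set κ : ℝ := η / (16 * Real.pi * b) with hκ
  have hκ0 : 0 < κ := by positivity
  set f₁ : S2 → ℝ := fun y => b * (max (f y - N) 0 + κ) with hf₁
  set f₂ : S2 → ℝ := fun y => min (f y) N - κ with hf₂
  have hmax : Integrable (fun y => max (f y - N) 0) area :=
    (hf.sub (integrable_const (N : ℝ))).sup (integrable_const 0)
  have hf₁i : Integrable f₁ area := (hmax.add (integrable_const _)).const_mul b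
  have hf₂i : Integrable f₂ area := (hf.inf (integrable_const (N : ℝ))).sub (integrable_const κ)
  have hf₁0 : ∀ y, 0 ≤ f₁ y := fun y => by
    have := le_max_right (f y - N) 0
    positivity
  have hsplit : ∀ y, b * f y = f₁ y + b * f₂ y := fun y => by
    simp only [hf₁, hf₂]
    rcases le_total (f y) N with h | h
    · rw [max_eq_right (by linarith), min_eq_left h]; ring
    · rw [max_eq_left (by linarith), min_eq_right h]; ring
  set m := ∫ y, f₁ y ∂area with hm
  have hmval : m = b * (∫ y, max (f y - N) 0 ∂area + 4 * Real.pi * κ) := by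
    rw [hm, hf₁, integral_const_mul, integral_add hmax (integrable_const _), integral_const,
      area_real_univ, smul_eq_mul]
  have hmaxnn : 0 ≤ ∫ y, max (f y - N) 0 ∂area := integral_nonneg fun y => le_max_right _ _
  have hm0 : 0 < m := by rw [hmval]; positivity
  have hm1 : m < η / 2 := by
    rw [hmval]
    calc _ < b * (η / (4 * b) + 4 * Real.pi * κ) := by gcongr
      _ = η / 2 := by rw [hκ]; field_simp; norm_num
  obtain ⟨Cl, hCl0, hCl⟩ := exists_lintegral_log_le
  obtain ⟨C, hC0, hC⟩ := exists_lintegral_weight_le p (α := 1 - η) (β := m) (by linarith) hm0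
    (by linarith)
  have hlogf := (integrable_mul_log_kernel hf).swap.prod_right_ae
  have hlogf₁ := (integrable_mul_log_kernel hf₁i).swap.prod_right_ae
  have hlogf₂ := (integrable_mul_log_kernel hf₂i).swap.prod_right_ae
  set D := b * (((N : ℝ) + κ) * Cl) with hD
  have hf₂b : ∀ y, |f₂ y| ≤ N + κ := fun y => by
    have h1 : 0 ≤ min (f y) N := le_min (hf0 y) N.cast_nonneg
    have h2 : min (f y) N ≤ N := min_le_right _ _
    rw [abs_le]; constructor <;> simp only [hf₂] <;> linarith
  have hwnn : ∀ x, 0 ≤ (1 - dot x p ^ 2) ^ (-(1 - η)) := fun x =>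
    Real.rpow_nonneg (one_sub_sq_dot_nonneg x p) _
  have hwm : Measurable fun x => (1 - dot x p ^ 2) ^ (-(1 - η)) :=
    (((continuous_dot_left p).pow 2).measurable.const_sub 1).pow_const _
  -- the bounded part only contributes a constant factor
  have hpt : ∀ᵐ x ∂area, ENNReal.ofReal ((1 - dot x p ^ 2) ^ (-(1 - η)) *
      Real.exp (-(b * ∫ y, f y * Real.log (1 - dot y x) ∂area))) ≤
      ENNReal.ofReal ((1 - dot x p ^ 2) ^ (-(1 - η))) * (ENNReal.ofReal (Real.exp D) *
        (ENNReal.ofReal m⁻¹ * ∫⁻ y, ENNReal.ofReal (f₁ y * (1 - dot y x) ^ (-m)) ∂area)) := by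
    filter_upwards [hlogf, hlogf₁, hlogf₂] with x hx hx₁ hx₂
    simp only [Function.comp, Prod.swap] at hx hx₁ hx₂
    have e : b * ∫ y, f y * Real.log (1 - dot y x) ∂area =
        ∫ y, f₁ y * Real.log (1 - dot y x) ∂area +
          b * ∫ y, f₂ y * Real.log (1 - dot y x) ∂area := by
      rw [← integral_const_mul b fun y => f₂ y * Real.log (1 - dot y x),
        ← integral_const_mul b fun y => f y * Real.log (1 - dot y x),
        ← integral_add hx₁ (hx₂.const_mul b)]
      refine integral_congr_ae (.of_forall fun y => ?_)
      simp only
      rw [← mul_assoc, hsplit]; ring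
    have hb2 : |∫ y, f₂ y * Real.log (1 - dot y x) ∂area| ≤ ((N : ℝ) + κ) * Cl := by
      have hli := (integrable_log_kernel x).abs
      have h1 : ∫ y, |Real.log (1 - dot y x)| ∂area ≤ Cl := by
        rw [integral_eq_lintegral_of_nonneg_ae (.of_forall fun y => abs_nonneg _)
          hli.aestronglyMeasurable]
        exact ENNReal.toReal_le_of_le_ofReal hCl0 (hCl x)
      calc |∫ y, f₂ y * Real.log (1 - dot y x) ∂area|
          ≤ ∫ y, (N + κ) * |Real.log (1 - dot y x)| ∂area := by
            rw [← Real.norm_eq_abs]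
            refine norm_integral_le_of_norm_le (hli.const_mul _) (.of_forall fun y => ?_)
            rw [norm_mul]
            exact mul_le_mul_of_nonneg_right (hf₂b y) (abs_nonneg _)
        _ ≤ _ := by
            rw [integral_const_mul]
            exact mul_le_mul_of_nonneg_left h1 (by positivity)
    have hexp : Real.exp (-(b * ∫ y, f y * Real.log (1 - dot y x) ∂area)) ≤
        Real.exp D * Real.exp (-∫ y, f₁ y * Real.log (1 - dot y x) ∂area) := by
      rw [← Real.exp_add, e]
      refine Real.exp_le_exp.2 ?_
      have := mul_le_mul_of_nonneg_left (neg_le_of_abs_le hb2) hb.le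
      rw [hD]
      linarith
    rw [ENNReal.ofReal_mul (hwnn x)]
    gcongr
    refine (ENNReal.ofReal_le_ofReal hexp).trans ?_
    rw [ENNReal.ofReal_mul (Real.exp_pos _).le]
    gcongr
    exact ofReal_exp_potential_le hf₁0 hf₁i hm hm0 hx₁
  have hKm : AEMeasurable (fun q : S2 × S2 => ENNReal.ofReal ((1 - dot q.1 p ^ 2) ^ (-(1 - η)))
      * ENNReal.ofReal (f₁ q.2 * (1 - dot q.2 q.1) ^ (-m))) (area.prod area) := by
    refine AEMeasurable.mul (hwm.comp measurable_fst).ennreal_ofReal.aemeasurable ?_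
    refine AEMeasurable.ennreal_ofReal (AEMeasurable.mul ?_ ?_)
    · exact hf₁i.aestronglyMeasurable.comp_snd.aemeasurable
    · exact (((continuous_dot.comp continuous_swap).measurable.const_sub 1).pow_const
        _).aemeasurable
  refine ⟨hwm.aestronglyMeasurable.mul ?_, ?_⟩
  · refine Real.continuous_exp.comp_aestronglyMeasurable ?_
    exact ((integrable_mul_log_kernel hf).integral_prod_right.const_mul b).neg.aestronglyMeasurable
  rw [hasFiniteIntegral_iff_ofReal (.of_forall fun x => mul_nonneg (hwnn x) (Real.exp_pos _).le)]
  refine (lintegral_mono_ae hpt).trans_lt ?_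
  have e2 : ∀ x, ENNReal.ofReal ((1 - dot x p ^ 2) ^ (-(1 - η))) * (ENNReal.ofReal (Real.exp D) *
        (ENNReal.ofReal m⁻¹ * ∫⁻ y, ENNReal.ofReal (f₁ y * (1 - dot y x) ^ (-m)) ∂area)) =
      (ENNReal.ofReal (Real.exp D) * ENNReal.ofReal m⁻¹) * ∫⁻ y,
        ENNReal.ofReal ((1 - dot x p ^ 2) ^ (-(1 - η)))
          * ENNReal.ofReal (f₁ y * (1 - dot y x) ^ (-m)) ∂area := fun x => by
    rw [lintegral_const_mul' _ _ ENNReal.ofReal_ne_top]; ring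
  simp only [e2]
  rw [lintegral_const_mul' _ _ (ENNReal.mul_ne_top ENNReal.ofReal_ne_top ENNReal.ofReal_ne_top)]
  refine ENNReal.mul_lt_top (ENNReal.mul_lt_top ENNReal.ofReal_lt_top ENNReal.ofReal_lt_top) ?_
  rw [lintegral_lintegral_swap hKm]
  calc ∫⁻ y, ∫⁻ x, ENNReal.ofReal ((1 - dot x p ^ 2) ^ (-(1 - η)))
          * ENNReal.ofReal (f₁ y * (1 - dot y x) ^ (-m)) ∂area ∂area
      ≤ ∫⁻ y, ENNReal.ofReal (f₁ y) * ENNReal.ofReal C ∂area := by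
        refine lintegral_mono fun y => ?_
        refine le_trans (le_of_eq ?_) (mul_le_mul_right (hC y) _)
        rw [← lintegral_const_mul' _ _ ENNReal.ofReal_ne_top]
        refine lintegral_congr fun x => ?_
        rw [ENNReal.ofReal_mul (hf₁0 y), ENNReal.ofReal_mul (hwnn x), dot_comm y x]
        ring
    _ < ⊤ := by
        rw [lintegral_mul_const' _ _ ENNReal.ofReal_ne_top,
          ← ofReal_integral_eq_lintegral_ofReal hf₁i (.of_forall hf₁0)]
        exact ENNReal.mul_lt_top ENNReal.ofReal_lt_top ENNReal.ofReal_lt_top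

/-- The pairing `⟨X(x), y⟩` of `y` with the conformal field `X(x) = p - ⟨x, p⟩ x`. -/
noncomputable def fieldDot (p x y : S2) : ℝ := dot y p - dot x p * dot x y

lemma measurable_fieldDot (p : S2) : Measurable fun q : S2 × S2 => fieldDot p q.1 q.2 := by
  have h := continuous_dot_left p
  exact ((h.comp continuous_snd).sub ((h.comp continuous_fst).mul continuous_dot)).measurable

/-- The Cauchy–Schwarz inequality for the components of `p` and `y` orthogonal to `x`. -/
lemma sq_fieldDot_le (p x y : S2) :
    fieldDot p x y ^ 2 ≤ 2 * (1 - dot x p ^ 2) * (1 - dot x y) := by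
  have h := real_inner_mul_inner_self_le ((p : R3) - dot x p • (x : R3))
    ((y : R3) - dot x y • (x : R3))
  have e1 : inner ℝ ((p : R3) - dot x p • (x : R3)) ((y : R3) - dot x y • (x : R3))
      = fieldDot p x y := by
    simp only [inner_sub_left, inner_sub_right, real_inner_smul_left, real_inner_smul_right,
      real_inner_self_eq_norm_sq, norm_coe, fieldDot]
    simp only [dot, real_inner_comm (x : R3) (p : R3), real_inner_comm (y : R3) (p : R3)]
    ring
  have e2 : ∀ z : S2, inner ℝ ((z : R3) - dot x z • (x : R3)) ((z : R3) - dot x z • (x : R3))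
      = 1 - dot x z ^ 2 := fun z => by
    simp only [inner_sub_left, inner_sub_right, real_inner_smul_left, real_inner_smul_right,
      real_inner_self_eq_norm_sq, norm_coe, norm_smul, Real.norm_eq_abs, mul_pow, sq_abs]
    simp only [dot, real_inner_comm (x : R3) (z : R3)]
    ring
  rw [e1, e2, e2, ← sq] at h
  have h1 := one_sub_sq_dot_nonneg x p
  have h2 : 1 - dot x y ^ 2 ≤ 2 * (1 - dot x y) := by
    nlinarith [sq_nonneg (1 - dot x y)]
  nlinarith

/-- The distance `r` to the axis spanned by `p` satisfies `r(x)² ≤ 2 r(y)² + 2 |x - y|²`. -/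
lemma one_sub_sq_dot_le (p x y : S2) :
    1 - dot x p ^ 2 ≤ 2 * (1 - dot y p ^ 2) + 4 * (1 - dot x y) := by
  have h := real_inner_mul_inner_self_le ((2 : ℝ) • (y : R3) - (x : R3)) (p : R3)
  have e1 : inner ℝ ((2 : ℝ) • (y : R3) - (x : R3)) (p : R3) = 2 * dot y p - dot x p := by
    simp only [inner_sub_left, real_inner_smul_left, dot]
  have e2 : inner ℝ ((2 : ℝ) • (y : R3) - (x : R3)) ((2 : ℝ) • (y : R3) - (x : R3)) =
      5 - 4 * dot x y := by
    simp only [inner_sub_left, inner_sub_right, real_inner_smul_left, real_inner_smul_right,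
      real_inner_self_eq_norm_sq, norm_coe, norm_smul, dot, real_inner_comm (x : R3) (y : R3)]
    norm_num
    ring
  rw [e1, e2, real_inner_self_eq_norm_sq, norm_coe] at h
  nlinarith [sq_nonneg (dot x p - dot y p)]

/-- The pointwise estimate behind the finiteness of the interaction energy: `P`, `Q` are the squared
distances of two points to the axis, `d` half of their squared distance, `K` the pairing. -/
lemma interaction_le {u v P Q d K η : ℝ} (hu : 0 ≤ u) (hv : 0 ≤ v) (hP : 0 < P) (hQ : 0 < Q)
    (hd : 0 < d) (hPQ : P ≤ 2 * Q + 4 * d) (hK : K ^ 2 ≤ 2 * P * d) :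
    u * v * (K / d) ≤ 4 * (u * v) +
      ((u ^ 2 * P ^ (1 - η)) * (Q ^ (-(1 / 2 - η)) * d ^ (-(1 / 2) : ℝ))
        + (v ^ 2 * Q ^ (1 - η)) * (P ^ (-(1 / 2 - η)) * d ^ (-(1 / 2) : ℝ))) := by
  set A := u ^ 2 * P ^ (1 - η) * Q ^ (-(1 / 2 - η)) with hA
  set B := v ^ 2 * Q ^ (1 - η) * P ^ (-(1 / 2 - η)) with hB
  have hA0 : 0 ≤ A := by positivity
  have hB0 : 0 ≤ B := by positivity
  have hdp : 0 < d ^ (-(1 / 2) : ℝ) := Real.rpow_pos_of_pos hd _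
  have e : (u ^ 2 * P ^ (1 - η)) * (Q ^ (-(1 / 2 - η)) * d ^ (-(1 / 2) : ℝ))
        + (v ^ 2 * Q ^ (1 - η)) * (P ^ (-(1 / 2 - η)) * d ^ (-(1 / 2) : ℝ))
      = (A + B) * d ^ (-(1 / 2) : ℝ) := by rw [hA, hB]; ring
  rw [e]
  -- either the points are far apart compared with `P`, or `P` and `Q` are comparable
  rcases le_total P (8 * d) with h | h
  · have h1 : K ≤ 4 * d := by
      refine abs_le_of_sq_le_sq' ?_ (by positivity) |>.2
      nlinarith
    have h2 : K / d ≤ 4 := (div_le_iff₀ hd).2 h1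
    have h3 := mul_le_mul_of_nonneg_left h2 (mul_nonneg hu hv)
    have h4 : 0 ≤ (A + B) * d ^ (-(1 / 2) : ℝ) := by positivity
    linarith
  · have hPQ' : P ≤ 4 * Q := by linarith
    have hP1 : P ^ (1 - η) * P ^ (-(1 / 2 - η)) = √P := by
      rw [← Real.rpow_add hP, Real.sqrt_eq_rpow]; ring_nf
    have hQ1 : Q ^ (1 - η) * Q ^ (-(1 / 2 - η)) = √Q := by
      rw [← Real.rpow_add hQ, Real.sqrt_eq_rpow]; ring_nf
    have hAB : A * B = u ^ 2 * v ^ 2 * (√P * √Q) := by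
      rw [← hP1, ← hQ1, hA, hB]; ring
    have hsq : √P ≤ 2 * √Q := by
      rw [show (2 : ℝ) = √4 by rw [show (4 : ℝ) = 2 ^ 2 by norm_num]; simp,
        ← Real.sqrt_mul (by norm_num)]
      exact Real.sqrt_le_sqrt hPQ'
    have hP2 : P ≤ 2 * (√P * √Q) := by
      have := mul_le_mul_of_nonneg_left hsq (Real.sqrt_nonneg P)
      rw [Real.mul_self_sqrt hP.le] at this
      linarith
    have h1 : (u * v * K) ^ 2 ≤ ((A + B) * √d) ^ 2 := by
      calc (u * v * K) ^ 2 = u ^ 2 * v ^ 2 * K ^ 2 := by ring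
        _ ≤ u ^ 2 * v ^ 2 * (2 * P * d) := by gcongr
        _ ≤ u ^ 2 * v ^ 2 * (2 * (2 * (√P * √Q)) * d) := by gcongr
        _ = 4 * (A * B) * d := by rw [hAB]; ring
        _ ≤ (A + B) ^ 2 * d := by
            refine mul_le_mul_of_nonneg_right ?_ hd.le
            nlinarith [sq_nonneg (A - B)]
        _ = _ := by rw [mul_pow, Real.sq_sqrt hd.le]
    have h2 : u * v * K ≤ (A + B) * √d := (abs_le_of_sq_le_sq' h1 (by positivity)).2
    have h3 : √d / d = d ^ (-(1 / 2) : ℝ) := by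
      rw [Real.sqrt_div_self', Real.rpow_neg hd.le, Real.sqrt_eq_rpow, one_div]
    calc u * v * (K / d) = u * v * K / d := by ring
      _ ≤ (A + B) * √d / d := by gcongr
      _ = (A + B) * d ^ (-(1 / 2) : ℝ) := by rw [mul_div_assoc, h3]
      _ ≤ _ := by
          have := mul_nonneg hu hv
          linarith

lemma ae_prod_generic (p : S2) : ∀ᵐ q ∂(area.prod area),
    (q.1 ≠ p ∧ q.1 ≠ -p) ∧ (q.2 ≠ p ∧ q.2 ≠ -p) ∧ dot q.1 q.2 < 1 := by
  filter_upwards [Measure.quasiMeasurePreserving_fst.ae (ae_ne_poles p),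
    Measure.quasiMeasurePreserving_snd.ae (ae_ne_poles p), ae_prod_dot_lt_one area] with q h1 h2 h3
  exact ⟨h1, h2, h3⟩

/-- Finiteness of the interaction energy. The field `X` vanishes at its poles, which compensates for
a concentration of the density there. -/
theorem integrable_interaction (p : S2) {f : S2 → ℝ} (hf : Integrable f area) (hf0 : ∀ x, 0 ≤ f x)
    {η : ℝ} (hη : 0 < η) (hη2 : η < 1 / 2)
    (hH : Integrable (fun x => f x ^ 2 * (1 - dot x p ^ 2) ^ (1 - η)) area) :
    Integrable (fun q : S2 × S2 => f q.1 * f q.2 * (|fieldDot p q.1 q.2| / (1 - dot q.1 q.2)))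
      (area.prod area) := by
  obtain ⟨C, -, hC⟩ := exists_lintegral_weight_le p (α := 1 / 2 - η) (β := 1 / 2)
    (by linarith) (by norm_num) (by linarith)
  have hκm : Measurable fun q : S2 × S2 =>
      (1 - dot q.2 p ^ 2) ^ (-(1 / 2 - η)) * (1 - dot q.1 q.2) ^ (-(1 / 2) : ℝ) := by
    refine Measurable.mul ?_ ?_
    · exact ((((continuous_dot_left p).comp continuous_snd).pow 2).measurable.const_sub
        1).pow_const _
    · exact (continuous_dot.measurable.const_sub 1).pow_const _
  have h1 := integrable_mul_kernel hH hκm (C := C) fun x => by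
    refine le_trans (le_of_eq (lintegral_congr fun y => ?_)) (hC x)
    rw [abs_of_nonneg, dot_comm x y]
    exact mul_nonneg (Real.rpow_nonneg (one_sub_sq_dot_nonneg _ _) _)
      (Real.rpow_nonneg (by linarith [dot_le_one x y]) _)
  have h2 := h1.swap
  have h0 := (hf.mul_prod hf).const_mul 4
  refine (h0.add (h1.add h2)).mono' ?_ ?_
  · exact (hf.aestronglyMeasurable.comp_fst.mul hf.aestronglyMeasurable.comp_snd).mul
      ((measurable_fieldDot p).abs.div (continuous_dot.measurable.const_sub 1)).aestronglyMeasurable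
  · filter_upwards [ae_prod_generic p] with ⟨x, y⟩ hq
    obtain ⟨hx, hy, hxy⟩ := hq
    simp only [Pi.add_apply, Function.comp, Prod.swap] at *
    have hd : 0 < 1 - dot x y := by linarith
    rw [Real.norm_of_nonneg (mul_nonneg (mul_nonneg (hf0 x) (hf0 y)) (by positivity)),
      dot_comm y x]
    refine interaction_le (hf0 x) (hf0 y) (one_sub_sq_dot_pos hx) (one_sub_sq_dot_pos hy) hd
      (one_sub_sq_dot_le p x y) ?_
    rw [sq_abs]
    exact sq_fieldDot_le p x y

/-! ### Derivatives along the conformal field -/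

lemma IsSmooth.contDiffAt_radialExt {K : S2 → ℝ} (hK : IsSmooth K) {z : R3} (hz : z ≠ 0) :
    ContDiffAt ℝ ∞ (radialExt K) z := by
  have : Fact (Module.finrank ℝ R3 = 2 + 1) := ⟨by simp⟩
  -- the radial projection is smooth on the open submanifold `ℝ³ ∖ {0}`
  let U : TopologicalSpace.Opens R3 := ⟨{0}ᶜ, isOpen_compl_singleton⟩
  have hU : ∀ w : U, (w : R3) ≠ 0 := fun w => w.2
  have hn : ∀ w : U, ‖(w : R3)‖⁻¹ • (w : R3) ∈ Metric.sphere (0 : R3) 1 := fun w => by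
    rw [mem_sphere_zero_iff_norm, norm_smul, norm_inv, norm_norm,
      inv_mul_cancel₀ (norm_ne_zero_iff.mpr (hU w))]
  have hsm : ContMDiff 𝓘(ℝ, R3) 𝓘(ℝ, R3) ∞ fun w : U => ‖(w : R3)‖⁻¹ • (w : R3) := fun w => by
    refine (contMDiffAt_subtype_iff (f := fun w : R3 => ‖w‖⁻¹ • w)).2 (ContDiffAt.contMDiffAt ?_)
    exact ((contDiffAt_norm ℝ (hU w)).inv (norm_ne_zero_iff.mpr (hU w))).smul contDiffAt_id
  have hπ := hsm.codRestrict_sphere (n := 2) hn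
  have hc : ContMDiff 𝓘(ℝ, R3) 𝓘(ℝ) ∞ (fun w : U => radialExt K w) := by
    refine (ContMDiff.comp hK hπ).congr fun w => ?_
    simp only [radialExt, dif_pos (hU w)]
    rfl
  exact ((contMDiffAt_subtype_iff (f := radialExt K) (x := (⟨z, hz⟩ : U))).1
    (hc.contMDiffAt)).contDiffAt

lemma inner_grad (f : S2 → ℝ) (x : S2) (w : R3) :
    inner ℝ (grad f x) w = fderiv ℝ (radialExt f) (x : R3) w := by
  simp [grad, gradient]

lemma grad_dot (p x : S2) : grad (fun x => dot x p) x = (p : R3) - dot x p • (x : R3) := by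
  refine ext_inner_right ℝ fun w => ?_
  have hx := coe_ne_zero x
  have hd := (contDiffAt_radialExt_dot p hx (n := 1)).differentiableAt one_ne_zero
  rw [inner_grad, ← hd.lineDeriv_eq_fderiv,
    (hasLineDerivAt_radialExt_dot p hx w).lineDeriv, inner_sub_left, real_inner_smul_left,
    real_inner_comm]
  simp [dot]

/-- For `g` differentiable, `⟨∇g, ∇⟨·, p⟩⟩` is the derivative of the radial extension of `g` in the
direction `p`. -/
lemma hasLineDerivAt_inner_grad {g : S2 → ℝ} {x : S2} (p : S2)
    (hg : DifferentiableAt ℝ (radialExt g) (x : R3)) :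
    HasLineDerivAt ℝ (radialExt g) (inner ℝ (grad g x) (grad (fun x => dot x p) x))
      (x : R3) (p : R3) := by
  -- the radial derivative vanishes
  have hrad : fderiv ℝ (radialExt g) (x : R3) (x : R3) = 0 := by
    rw [← hg.lineDeriv_eq_fderiv]
    apply HasLineDerivAt.lineDeriv
    unfold HasLineDerivAt
    refine (hasDerivAt_const (0 : ℝ) (g x)).congr_of_eventuallyEq ?_
    filter_upwards [lt_mem_nhds (show (-1 : ℝ) < 0 by norm_num)] with t ht
    rw [show (x : R3) + t • (x : R3) = (1 + t) • (x : R3) by rw [add_smul, one_smul],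
      radialExt_smul _ (by linarith), radialExt_coe]
  rw [grad_dot, inner_sub_right, real_inner_smul_right, inner_grad, inner_grad, hrad, mul_zero,
    sub_zero]
  exact hg.hasFDerivAt.hasLineDerivAt _

lemma hasLineDerivAt_radialExt_mul {f g : S2 → ℝ} {f' g' : ℝ} {x : S2} {w : R3}
    (hf : HasLineDerivAt ℝ (radialExt f) f' (x : R3) w)
    (hg : HasLineDerivAt ℝ (radialExt g) g' (x : R3) w) :
    HasLineDerivAt ℝ (radialExt fun x => f x * g x) (f' * g x + f x * g') (x : R3) w := by
  unfold HasLineDerivAt at *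
  simp only [SingularLiouville.radialExt_mul]
  simpa using hf.fun_mul hg

lemma hasDerivAt_of_hasLineDerivAt {F : R3 → ℝ} {F' t : ℝ} {x w : R3}
    (h : HasLineDerivAt ℝ F F' (x + t • w) w) : HasDerivAt (fun t => F (x + t • w)) F' t := by
  unfold HasLineDerivAt at h
  have h1 := HasDerivAt.comp_sub_const (f := fun s : ℝ => F (x + t • w + s • w)) t t
    (by simpa using h)
  refine h1.congr_of_eventuallyEq (.of_forall fun s => ?_)
  simp only
  rw [add_assoc, ← add_smul]
  congr 3
  ring

/-- Differentiation of a regularized logarithmic potential. -/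
lemma hasLineDerivAt_potential (p x : S2) {f : S2 → ℝ} (hf : Integrable f area) {a : ℝ}
    (ha : 1 < a) :
    HasLineDerivAt ℝ (radialExt fun x => ∫ y, f y * Real.log (a - dot y x) ∂area)
      (-∫ y, f y * (fieldDot p x y / (a - dot x y)) ∂area) (x : R3) (p : R3) := by
  have hsub : ∀ t ∈ Metric.ball (0 : ℝ) (1 / 2), 1 / 2 ≤ ‖(x : R3) + t • (p : R3)‖ := fun t ht => by
    have h1 := norm_sub_norm_le (x : R3) (-(t • (p : R3)))
    rw [sub_neg_eq_add, norm_neg, norm_smul, norm_coe, norm_coe, mul_one] at h1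
    have : ‖t‖ < 1 / 2 := by simpa using ht
    linarith
  have hne : ∀ t ∈ Metric.ball (0 : ℝ) (1 / 2), (x : R3) + t • (p : R3) ≠ 0 := fun t ht => by
    have := hsub t ht
    exact norm_pos_iff.1 (by linarith)
  set N : ℝ → S2 → ℝ := fun t y => radialExt (fun x => dot x y) ((x : R3) + t • (p : R3)) with hN
  have hN1 : ∀ t ∈ Metric.ball (0 : ℝ) (1 / 2), ∀ y, N t y ≤ 1 := fun t ht y => by
    obtain ⟨x', h⟩ := exists_radialExt_eq (fun x => dot x y) (hne t ht)
    rw [hN]; simp only; rw [h]; exact dot_le_one x' y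
  set N' : ℝ → S2 → ℝ := fun t y => inner ℝ (p : R3) (y : R3) / ‖(x : R3) + t • (p : R3)‖
    - inner ℝ ((x : R3) + t • (p : R3)) (y : R3) * inner ℝ ((x : R3) + t • (p : R3)) (p : R3)
      / ‖(x : R3) + t • (p : R3)‖ ^ 3
  have hNm : ∀ t, Measurable (N t) := fun t => by
    simp only [hN, radialExt_dot]
    exact Measurable.div_const (by fun_prop) _
  have h0 : (0 : ℝ) ∈ Metric.ball (0 : ℝ) (1 / 2) := by simp
  have hderiv : ∀ᵐ y ∂area, ∀ t ∈ Metric.ball (0 : ℝ) (1 / 2),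
      HasDerivAt (fun t => f y * Real.log (a - N t y)) (f y * (-N' t y / (a - N t y))) t := by
    refine .of_forall fun y t ht => ?_
    have h := hasDerivAt_of_hasLineDerivAt (hasLineDerivAt_radialExt_dot y (hne t ht) (p : R3))
    refine HasDerivAt.const_mul _ (HasDerivAt.log (h.const_sub a) ?_)
    have := hN1 t ht y
    exact (show 0 < a - N t y by linarith).ne'
  have hbound : ∀ᵐ y ∂area, ∀ t ∈ Metric.ball (0 : ℝ) (1 / 2),
      ‖f y * (-N' t y / (a - N t y))‖ ≤ |f y| * (4 / (a - 1)) := by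
    refine .of_forall fun y t ht => ?_
    rw [norm_mul, norm_div, norm_neg, Real.norm_eq_abs]
    refine mul_le_mul_of_nonneg_left ?_ (abs_nonneg _)
    have hd : a - 1 ≤ ‖a - N t y‖ :=
      (by linarith [hN1 t ht y] : a - 1 ≤ a - N t y).trans (le_abs_self _)
    refine div_le_div₀ (by norm_num) ?_ (by linarith) hd
    set z := (x : R3) + t • (p : R3)
    have hz := hsub t ht
    have hz0 : 0 < ‖z‖ := by linarith
    have b1 : ‖inner ℝ (p : R3) (y : R3) / ‖z‖‖ ≤ 2 := by
      rw [norm_div, norm_norm, div_le_iff₀ hz0]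
      have := norm_inner_le_norm (𝕜 := ℝ) (p : R3) (y : R3)
      rw [norm_coe, norm_coe] at this
      linarith
    have b2 : ‖inner ℝ z (y : R3) * inner ℝ z (p : R3) / ‖z‖ ^ 3‖ ≤ 2 := by
      rw [norm_div, norm_mul, norm_pow, norm_norm, div_le_iff₀ (by positivity)]
      have i1 := norm_inner_le_norm (𝕜 := ℝ) z (y : R3)
      have i2 := norm_inner_le_norm (𝕜 := ℝ) z (p : R3)
      rw [norm_coe, mul_one] at i1 i2
      calc _ ≤ ‖z‖ * ‖z‖ := by gcongr
        _ ≤ ‖z‖ * ‖z‖ * (2 * ‖z‖) := by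
            refine le_mul_of_one_le_right (by positivity) (by linarith)
        _ = _ := by ring
    calc ‖N' t y‖ ≤ _ := norm_sub_le _ _
      _ ≤ 4 := by linarith
  have hlogc : Continuous fun y : S2 => Real.log (a - dot x y) :=
    (continuous_const.sub (continuous_dot_right x)).log
      fun y => (sub_dot_pos ha x y).ne'
  obtain ⟨D, hD⟩ := (isCompact_univ (X := S2)).exists_bound_of_continuousOn hlogc.continuousOn
  have hN0 : ∀ y, N 0 y = dot x y := fun y => by simp [hN]
  have key := hasDerivAt_integral_of_dominated_loc_of_deriv_le
    (μ := area) (F := fun t y => f y * Real.log (a - N t y))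
    (F' := fun t y => f y * (-N' t y / (a - N t y))) (x₀ := (0 : ℝ))
    (bound := fun y => |f y| * (4 / (a - 1))) (s := Metric.ball 0 (1 / 2))
    (Metric.ball_mem_nhds _ (by norm_num))
    (.of_forall fun t => hf.aestronglyMeasurable.mul
      (Real.measurable_log.comp ((hNm t).const_sub a)).aestronglyMeasurable)
    (by
      simp only [hN0]
      exact hf.mul_bdd hlogc.aestronglyMeasurable (.of_forall fun y => hD y (mem_univ y)))
    (by
      refine hf.aestronglyMeasurable.mul (Measurable.aestronglyMeasurable ?_)
      refine Measurable.div (Measurable.neg ?_) ((hNm 0).const_sub a)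
      refine Measurable.sub (Measurable.div_const (by fun_prop) _) (Measurable.div_const ?_ _)
      exact Measurable.mul_const (by fun_prop) _)
    hbound (hf.abs.mul_const _) hderiv
  unfold HasLineDerivAt
  have hev : (fun t : ℝ => radialExt (fun x => ∫ y, f y * Real.log (a - dot y x) ∂area)
      ((x : R3) + t • (p : R3))) =ᶠ[𝓝 0] fun t => ∫ y, f y * Real.log (a - N t y) ∂area := by
    filter_upwards [Metric.ball_mem_nhds (0 : ℝ) (show (0 : ℝ) < 1 / 2 by norm_num)] with t ht
    simp only [hN, radialExt, dif_pos (hne t ht)]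
    exact integral_congr_ae (.of_forall fun y => by simp only [dot_comm y])
  refine (key.2.congr_of_eventuallyEq hev).congr_deriv ?_
  rw [← integral_neg]
  refine integral_congr_ae (.of_forall fun y => ?_)
  simp only [hN0, N', zero_smul, add_zero, norm_coe, fieldDot, dot, div_one, one_pow,
    real_inner_comm (p : R3) (y : R3)]
  ring

/-! ### The Pohozaev identity for densities given by their own potential -/

/-- Symmetrization of the interaction: `⟨X(x), y⟩ + ⟨X(y), x⟩ = (⟨x, p⟩ + ⟨y, p⟩) (1 - ⟨x, y⟩)`, so
that the singularity of the kernel cancels. -/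
lemma integral_interaction (p : S2) {f : S2 → ℝ} (hf : Integrable f area)
    (hI : Integrable (fun q : S2 × S2 => f q.1 * f q.2 * (fieldDot p q.1 q.2 / (1 - dot q.1 q.2)))
      (area.prod area)) :
    ∫ q, f q.1 * f q.2 * (fieldDot p q.1 q.2 / (1 - dot q.1 q.2)) ∂(area.prod area) =
      (∫ x, f x ∂area) * ∫ x, f x * dot x p ∂area := by
  have hfp : Integrable (fun x => f x * dot x p) area :=
    hf.mul_bdd (c := 1) (by fun_prop) (.of_forall fun x => abs_dot_le_one x p)
  set J := ∫ q, f q.1 * f q.2 * (fieldDot p q.1 q.2 / (1 - dot q.1 q.2)) ∂(area.prod area) with hJ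
  have hswap : J =
      ∫ q, f q.2 * f q.1 * (fieldDot p q.2 q.1 / (1 - dot q.2 q.1)) ∂(area.prod area) := by
    rw [hJ, ← integral_prod_swap]
    rfl
  have hsum : J + J = ∫ q, (f q.1 * dot q.1 p * f q.2 + f q.1 * (f q.2 * dot q.2 p))
      ∂(area.prod area) := by
    nth_rewrite 2 [hswap]
    have hI' : Integrable (fun q : S2 × S2 =>
      f q.2 * f q.1 * (fieldDot p q.2 q.1 / (1 - dot q.2 q.1))) (area.prod area) := hI.swap
    rw [hJ, ← integral_add hI hI']
    refine integral_congr_ae ?_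
    filter_upwards [ae_prod_dot_lt_one area] with q hq
    have hne : 1 - dot q.1 q.2 ≠ 0 := by linarith
    rw [dot_comm q.2 q.1]
    simp only [fieldDot, dot_comm q.2 q.1]
    field_simp
    ring
  rw [integral_add (hfp.mul_prod hf) (hf.mul_prod hfp),
    integral_prod_mul (fun x => f x * dot x p) f,
    integral_prod_mul f fun x => f x * dot x p] at hsum
  linarith

/-- The Pohozaev identity for a density `f = h e^u` whose logarithm `u` is the logarithmic potential
of `f`, and a weight `h` with bounded logarithmic derivative `B` along the conformal field. -/
theorem pohozaev_identity (p : S2) {h B u : S2 → ℝ} {b c β : ℝ} (hh : ∀ x, 0 < h x)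
    (hu : AEStronglyMeasurable u area)
    (hf : Integrable (fun x => h x * Real.exp (u x)) area)
    (hline : ∀ x : S2, x ≠ p → x ≠ -p →
      HasLineDerivAt ℝ (radialExt h) (h x * B x) (x : R3) (p : R3))
    (hBm : AEStronglyMeasurable B area) (hB : ∀ x, |B x| ≤ β) (hb : 0 ≤ b)
    (hrep : ∀ᵐ x ∂area, u x = c - b * ∫ y, h y * Real.exp (u y) * Real.log (1 - dot y x) ∂area)
    (hI : Integrable (fun q : S2 × S2 => h q.1 * Real.exp (u q.1) * (h q.2 * Real.exp (u q.2)) *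
      (|fieldDot p q.1 q.2| / (1 - dot q.1 q.2))) (area.prod area)) :
    ∫ x, h x * Real.exp (u x) * B x ∂area + b * ((∫ x, h x * Real.exp (u x) ∂area) *
        ∫ x, h x * Real.exp (u x) * dot x p ∂area)
      = 2 * ∫ x, h x * Real.exp (u x) * dot x p ∂area := by
  set f : S2 → ℝ := fun x => h x * Real.exp (u x) with hfdef
  have hf0 : ∀ x, 0 < f x := fun x => mul_pos (hh x) (Real.exp_pos _)
  have hhm : AEStronglyMeasurable h area := by
    have : h = fun x => f x * Real.exp (-u x) := by
      funext x
      rw [hfdef, mul_assoc, ← Real.exp_add, add_neg_cancel, Real.exp_zero, mul_one]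
    rw [this]
    exact hf.aestronglyMeasurable.mul (Real.continuous_exp.comp_aestronglyMeasurable hu.neg)
  have ha1 : ∀ᶠ a : ℝ in 𝓝[>] 1, 1 < a := self_mem_nhdsWithin
  -- up to a constant, `-b P a` increases to `u` as `a` decreases to `1`
  set P : ℝ → S2 → ℝ := fun a x => ∫ y, f y * Real.log (a - dot y x) ∂area with hP
  set g : ℝ → S2 → ℝ := fun a x => h x * Real.exp (c - b * P a x) with hg
  have hg0 : ∀ a x, 0 < g a x := fun a x => mul_pos (hh x) (Real.exp_pos _)
  have hlog := (integrable_mul_log_kernel hf).swap.prod_right_ae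
  have hgle : ∀ a : ℝ, 1 < a → ∀ᵐ x ∂area, g a x ≤ f x := by
    intro a ha
    filter_upwards [hlog, hrep] with x hx hux
    simp only [Function.comp, Prod.swap] at hx
    simp only [hg, hfdef]
    refine mul_le_mul_of_nonneg_left (Real.exp_le_exp.2 ?_) (hh x).le
    rw [hux]
    have hbd : ∃ D, ∀ y, ‖Real.log (a - dot y x)‖ ≤ D := by
      have hlogc : Continuous fun y : S2 => Real.log (a - dot y x) :=
        (continuous_const.sub (continuous_dot_left x)).log fun y => (sub_dot_pos ha y x).ne'
      obtain ⟨D, hD⟩ := (isCompact_univ (X := S2)).exists_bound_of_continuousOn hlogc.continuousOn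
      exact ⟨D, fun y => hD y (mem_univ y)⟩
    obtain ⟨D, hD⟩ := hbd
    have hia : Integrable (fun y => f y * Real.log (a - dot y x)) area :=
      hf.mul_bdd (Real.measurable_log.comp
        ((continuous_dot_left x).measurable.const_sub a)).aestronglyMeasurable (.of_forall hD)
    have hmono : ∫ y, f y * Real.log (1 - dot y x) ∂area ≤ P a x := by
      refine integral_mono_ae hx hia ?_
      filter_upwards [ae_ne_poles x] with y hy
      exact mul_le_mul_of_nonneg_left (log_one_sub_le_log_sub (dot_lt_one hy.1) ha) (hf0 y).le
    have := mul_le_mul_of_nonneg_left hmono hb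
    linarith
  have hgm : ∀ a, AEStronglyMeasurable (g a) area := fun a => by
    refine hhm.mul (Real.continuous_exp.comp_aestronglyMeasurable ?_)
    refine aestronglyMeasurable_const.sub (AEStronglyMeasurable.const_mul ?_ b)
    refine AEStronglyMeasurable.integral_prod_right' (f := fun q : S2 × S2 =>
      f q.2 * Real.log (a - dot q.2 q.1)) ?_
    exact hf.aestronglyMeasurable.comp_snd.mul
      ((measurable_log_kernel a).comp measurable_swap).aestronglyMeasurable
  have hgi : ∀ a : ℝ, 1 < a → Integrable (g a) area := fun a ha =>
    hf.mono' (hgm a) ((hgle a ha).mono fun x hx => by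
      rwa [Real.norm_of_nonneg (hg0 a x).le])
  have hglim : ∀ᵐ x ∂area, Tendsto (fun a => g a x) (𝓝[>] 1) (𝓝 (f x)) := by
    filter_upwards [hlog, hrep] with x hx hux
    simp only [Function.comp, Prod.swap] at hx
    have h1 := tendsto_integral_mul_log (continuous_dot_left x).measurable
      (fun y => neg_one_le_dot y x) ((ae_ne_poles x).mono fun y hy => dot_lt_one hy.1) hf hx
    have h2 := ((Real.continuous_exp.tendsto _).comp ((h1.const_mul b).const_sub c)).const_mul (h x)
    rw [← hux] at h2
    exact h2
  -- a bounded factor does not affect the passage to the limit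
  have hlim1 : ∀ (w : S2 → ℝ) (D : ℝ), AEStronglyMeasurable w area → (∀ x, |w x| ≤ D) →
      Tendsto (fun a => ∫ x, g a x * w x ∂area) (𝓝[>] 1) (𝓝 (∫ x, f x * w x ∂area)) := by
    intro w D hw hD
    refine tendsto_integral_filter_of_dominated_convergence (fun x => f x * D)
      (.of_forall fun a => (hgm a).mul hw) ?_ (hf.mul_const D)
      (hglim.mono fun x hx => hx.mul_const _)
    filter_upwards [ha1] with a ha
    filter_upwards [hgle a ha] with x hx
    rw [norm_mul, Real.norm_of_nonneg (hg0 a x).le]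
    exact mul_le_mul hx (hD x) (abs_nonneg _) (hf0 x).le
  set F : ℝ → S2 × S2 → ℝ := fun a q =>
    g a q.1 * (f q.2 * (fieldDot p q.1 q.2 / (a - dot q.1 q.2))) with hF
  have hFm : ∀ a, AEStronglyMeasurable (F a) (area.prod area) := fun a =>
    (hgm a).comp_fst.mul (hf.aestronglyMeasurable.comp_snd.mul
      ((measurable_fieldDot p).div (continuous_dot.measurable.const_sub a)).aestronglyMeasurable)
  have hFle : ∀ a : ℝ, 1 < a → ∀ᵐ q ∂(area.prod area), ‖F a q‖ ≤
      f q.1 * f q.2 * (|fieldDot p q.1 q.2| / (1 - dot q.1 q.2)) := by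
    intro a ha
    filter_upwards [Measure.quasiMeasurePreserving_fst.ae (hgle a ha), ae_prod_dot_lt_one area]
      with q hq hs
    rw [hF]
    simp only [norm_mul, norm_div]
    rw [Real.norm_of_nonneg (hg0 a q.1).le, Real.norm_of_nonneg (hf0 q.2).le, Real.norm_eq_abs,
      Real.norm_of_nonneg (sub_dot_pos ha q.1 q.2).le, ← mul_assoc]
    have h1 : 0 < 1 - dot q.1 q.2 := by linarith
    have h2 := (hf0 q.2).le
    have h3 := (hf0 q.1).le
    have h4 : 0 < a - dot q.1 q.2 := sub_dot_pos ha _ _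
    gcongr
  have hFi : ∀ a : ℝ, 1 < a → Integrable (F a) (area.prod area) := fun a ha =>
    hI.mono' (hFm a) (hFle a ha)
  have hlim2 : Tendsto (fun a => ∫ q, F a q ∂(area.prod area)) (𝓝[>] 1)
      (𝓝 (∫ q, f q.1 * f q.2 * (fieldDot p q.1 q.2 / (1 - dot q.1 q.2)) ∂(area.prod area))) := by
    refine tendsto_integral_filter_of_dominated_convergence _ (.of_forall hFm)
      (ha1.mono hFle) hI ?_
    filter_upwards [Measure.quasiMeasurePreserving_fst.ae hglim, ae_prod_dot_lt_one area]
      with q hq hs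
    simp only [hF, mul_assoc]
    refine hq.mul (Tendsto.const_mul _ (Tendsto.div tendsto_const_nhds ?_ (by linarith)))
    exact ((continuous_id.sub continuous_const).tendsto 1).mono_left nhdsWithin_le_nhds
  have hident : ∀ a : ℝ, 1 < a → ∫ x, g a x * B x ∂area + b * ∫ q, F a q ∂(area.prod area)
      = 2 * ∫ x, g a x * dot x p ∂area := by
    intro a ha
    set W : S2 → ℝ := fun x => ∫ y, f y * (fieldDot p x y / (a - dot x y)) ∂area with hW
    have hgW : Integrable (fun x => g a x * W x) area :=
      (hFi a ha).integral_prod_left.congr (.of_forall fun x => by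
        simp only [hF, hW, integral_const_mul])
    have hgB : Integrable (fun x => g a x * B x) area :=
      (hgi a ha).mul_bdd hBm (.of_forall hB)
    have hd : ∀ x : S2, x ≠ p → x ≠ -p → HasLineDerivAt ℝ (radialExt (g a))
        (g a x * B x + b * (g a x * W x)) (x : R3) (p : R3) := by
      intro x h1 h2
      have hexp : HasDerivAt (fun s => Real.exp (c - b * s))
          (Real.exp (c - b * radialExt (P a) (x : R3)) * (-b)) (radialExt (P a) (x : R3)) := by
        simpa using (((hasDerivAt_id _).const_mul b).const_sub c).exp
      have h3 := hasLineDerivAt_radialExt_comp (coe_ne_zero x) hexp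
        (hasLineDerivAt_potential p x hf ha)
      have h4 := hasLineDerivAt_radialExt_mul (hline x h1 h2) h3
      rw [radialExt_coe] at h4
      convert! h4 using 1
      simp only [hg, hW, mul_neg, neg_mul, neg_neg]
      ring
    have h5 := integral_conformal_field p hd (hgi a ha) (hgB.add (hgW.const_mul b))
    rw [integral_add hgB (hgW.const_mul b), integral_const_mul] at h5
    rw [← h5, integral_prod _ (hFi a ha)]
    simp only [hF, hW, integral_const_mul]
  have hIs : Integrable (fun q : S2 × S2 => f q.1 * f q.2 *
      (fieldDot p q.1 q.2 / (1 - dot q.1 q.2))) (area.prod area) := by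
    refine hI.mono' ?_ ?_
    · exact (hf.aestronglyMeasurable.comp_fst.mul hf.aestronglyMeasurable.comp_snd).mul
        ((measurable_fieldDot p).div (continuous_dot.measurable.const_sub 1)).aestronglyMeasurable
    · refine .of_forall fun q => le_of_eq ?_
      rw [norm_mul, norm_div, Real.norm_of_nonneg (mul_pos (hf0 q.1) (hf0 q.2)).le,
        Real.norm_of_nonneg (show 0 ≤ 1 - dot q.1 q.2 by linarith [dot_le_one q.1 q.2]),
        Real.norm_eq_abs]
  rw [← integral_interaction p hf hIs]
  refine tendsto_nhds_unique (((hlim1 B β hBm hB).add (hlim2.const_mul b)).congr' ?_)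
    ((hlim1 (fun x => dot x p) 1 (by fun_prop) fun x => abs_dot_le_one x p).const_mul 2)
  filter_upwards [ha1] with a ha using hident a ha

/-! ### The weight -/

/-- Off the poles, where the exponents of the Green functions are logarithms, the weight is
explicit. Its values at the poles are immaterial. -/
lemma weight_eq {p : S2} {K G₁ G₂ : S2 → ℝ} (hG₁ : IsGreenFunction p G₁)
    (hG₂ : IsGreenFunction (-p) G₂) (α₁ α₂ : ℝ) :
    ∃ k : ℝ, 0 < k ∧ ∀ x, x ≠ p → x ≠ -p → weight K G₁ G₂ α₁ α₂ x =
      k * (K x * ((1 - dot x p) ^ α₁ * (1 + dot x p) ^ α₂)) := by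
  obtain ⟨c₁, h₁⟩ := hG₁.eq
  obtain ⟨c₂, h₂⟩ := hG₂.eq
  refine ⟨Real.exp (-4 * Real.pi * α₁ * c₁ - 4 * Real.pi * α₂ * c₂), Real.exp_pos _,
    fun x hx hx' => ?_⟩
  have hpi := Real.pi_pos
  have e1 : 0 < 1 - dot x p := by linarith [dot_lt_one hx]
  have e2 : 0 < 1 + dot x p := by linarith [neg_one_lt_dot hx']
  rw [weight, h₁ x hx, h₂ x hx', dot_neg_right, sub_neg_eq_add, Real.rpow_def_of_pos e1,
    Real.rpow_def_of_pos e2, ← Real.exp_add, mul_left_comm, ← Real.exp_add]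
  congr 2
  field_simp
  ring

/-- The logarithmic derivative of the weight along the conformal field. The singularities of the
factors `(1 - x₃)^α₁` and `(1 + x₃)^α₂` cancel against the zeros of the field. -/
noncomputable def weightLogDeriv (p : S2) (K : S2 → ℝ) (α₁ α₂ : ℝ) (x : S2) : ℝ :=
  fderiv ℝ (radialExt K) (x : R3) (p : R3) / K x - α₁ * (1 + dot x p) + α₂ * (1 - dot x p)

lemma continuous_weightLogDeriv (p : S2) {K : S2 → ℝ} (hK : IsSmooth K) (hK0 : ∀ x, 0 < K x)
    (α₁ α₂ : ℝ) : Continuous (weightLogDeriv p K α₁ α₂) := by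
  have h1 : Continuous fun x : S2 => fderiv ℝ (radialExt K) (x : R3) := by
    refine continuous_iff_continuousAt.2 fun x => ?_
    have := ((hK.contDiffAt_radialExt (coe_ne_zero x)).fderiv_right (m := 0) (by simp)).continuousAt
    exact ContinuousAt.comp (f := fun x : S2 => (x : R3)) this continuous_subtype_val.continuousAt
  have h2 : Continuous K := ContMDiff.continuous hK
  unfold weightLogDeriv
  exact (((h1.clm_apply continuous_const).div h2 fun x => (hK0 x).ne').sub (by fun_prop)).add
    (by fun_prop)

lemma hasDerivAt_zonal_weight {s : ℝ} (h1 : -1 < s) (h2 : s < 1) (α₁ α₂ : ℝ) :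
    HasDerivAt (fun s : ℝ => (1 - s) ^ α₁ * (1 + s) ^ α₂)
      ((1 - s) ^ α₁ * (1 + s) ^ α₂ * (-α₁ / (1 - s) + α₂ / (1 + s))) s := by
  have e1 : 1 - s ≠ 0 := by linarith
  have e2 : 1 + s ≠ 0 := by linarith
  have d1 := (((hasDerivAt_id s).const_sub 1)).rpow_const (p := α₁) (.inl e1)
  have d2 := (((hasDerivAt_id s).const_add 1)).rpow_const (p := α₂) (.inl e2)
  refine (d1.fun_mul d2).congr_deriv ?_
  simp only [id_eq]
  rw [Real.rpow_sub_one e1, Real.rpow_sub_one e2]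
  field_simp

lemma radialExt_const_mul (k : ℝ) (f : S2 → ℝ) (z : R3) :
    radialExt (fun x => k * f x) z = k * radialExt f z := by
  unfold radialExt
  split_ifs <;> simp

lemma radialExt_eventuallyEq {p : S2} {f g : S2 → ℝ} (hfg : ∀ x, x ≠ p → x ≠ -p → f x = g x)
    {x : S2} (h1 : x ≠ p) (h2 : x ≠ -p) : radialExt f =ᶠ[𝓝 (x : R3)] radialExt g := by
  have hx := coe_ne_zero x
  have hN := (contDiffAt_radialExt_dot p hx (n := 0)).continuousAt
  have hN1 : radialExt (fun x => dot x p) (x : R3) = dot x p := radialExt_coe _ x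
  have o1 : ∀ᶠ z in 𝓝 (x : R3), radialExt (fun x => dot x p) z < 1 :=
    hN.eventually_lt continuousAt_const (by rw [hN1]; exact dot_lt_one h1)
  have o2 : ∀ᶠ z in 𝓝 (x : R3), -1 < radialExt (fun x => dot x p) z :=
    continuousAt_const.eventually_lt hN (by rw [hN1]; exact neg_one_lt_dot h2)
  filter_upwards [isOpen_ne.mem_nhds hx, o1, o2] with z hz z1 z2
  obtain ⟨r, hr, x', rfl⟩ := exists_smul_coe hz
  simp only [radialExt_smul _ hr, radialExt_coe] at z1 z2 ⊢
  refine hfg x' ?_ ?_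
  · rintro rfl; simp at z1
  · intro h; rw [dot_eq_neg_one_iff.2 h] at z2; exact lt_irrefl _ z2

lemma differentiableAt_radialExt_weight {p : S2} {K h : S2 → ℝ} (hK : IsSmooth K) {k α₁ α₂ : ℝ}
    (hh : ∀ x, x ≠ p → x ≠ -p → h x = k * (K x * ((1 - dot x p) ^ α₁ * (1 + dot x p) ^ α₂)))
    {x : S2} (h1 : x ≠ p) (h2 : x ≠ -p) :
    DifferentiableAt ℝ (radialExt h) (x : R3) := by
  have hx := coe_ne_zero x
  have hN := (contDiffAt_radialExt_dot p hx (n := 1)).differentiableAt one_ne_zero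
  have hF := hasDerivAt_zonal_weight (neg_one_lt_dot h2) (dot_lt_one h1) α₁ α₂
  have hd : DifferentiableAt ℝ (fun z => k * (radialExt K z *
      ((fun s : ℝ => (1 - s) ^ α₁ * (1 + s) ^ α₂) (radialExt (fun x => dot x p) z)))) (x : R3) := by
    refine DifferentiableAt.const_mul (DifferentiableAt.mul
      ((hK.contDiffAt_radialExt hx).differentiableAt (by simp)) ?_) k
    refine DifferentiableAt.comp (x : R3) (g := fun s : ℝ => (1 - s) ^ α₁ * (1 + s) ^ α₂) ?_ hN
    rw [radialExt_coe]
    exact hF.differentiableAt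
  refine hd.congr_of_eventuallyEq ((radialExt_eventuallyEq hh h1 h2).trans ?_)
  filter_upwards [isOpen_ne.mem_nhds hx] with z hz
  rw [radialExt_const_mul, radialExt_mul,
    radialExt_comp (fun s : ℝ => (1 - s) ^ α₁ * (1 + s) ^ α₂) _ hz]

/-- Off the poles `X(h) = h B`, with `B` continuous on the whole sphere. -/
lemma inner_grad_weight {p : S2} {K h : S2 → ℝ} (hK : IsSmooth K) (hK0 : ∀ x, 0 < K x) {k α₁ α₂ : ℝ}
    (hh : ∀ x, x ≠ p → x ≠ -p → h x = k * (K x * ((1 - dot x p) ^ α₁ * (1 + dot x p) ^ α₂)))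
    {x : S2} (h1 : x ≠ p) (h2 : x ≠ -p) :
    inner ℝ (grad h x) (grad (fun x => dot x p) x) = h x * weightLogDeriv p K α₁ α₂ x := by
  have hx := coe_ne_zero x
  have hl := hasLineDerivAt_inner_grad p (differentiableAt_radialExt_weight hK hh h1 h2)
  have e1 : 1 - dot x p ≠ 0 := by linarith [dot_lt_one h1]
  have e2 : 1 + dot x p ≠ 0 := by linarith [neg_one_lt_dot h2]
  have e3 := (hK0 x).ne'
  have hKl : HasLineDerivAt ℝ (radialExt K) (fderiv ℝ (radialExt K) (x : R3) (p : R3))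
      (x : R3) (p : R3) :=
    ((hK.contDiffAt_radialExt hx).differentiableAt (by simp)).hasFDerivAt.hasLineDerivAt _
  have hz := hasLineDerivAt_zonal p x (p : R3)
    (hasDerivAt_zonal_weight (neg_one_lt_dot h2) (dot_lt_one h1) α₁ α₂)
  rw [inner_self_sub] at hz
  have hprod := hasLineDerivAt_radialExt_mul hKl hz
  have hk := (HasDerivAt.const_mul k hprod).congr_of_eventuallyEq
    (.of_forall fun t => radialExt_const_mul k _ ((x : R3) + t • (p : R3)))
  rw [hl.unique (HasLineDerivAt.congr_of_eventuallyEq hk (radialExt_eventuallyEq hh h1 h2)),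
    hh x h1 h2, weightLogDeriv]
  field_simp
  ring

/-- The weight is bounded by a power of the distance to the axis which is integrable. -/
lemma exists_weight_le {p : S2} {K h : S2 → ℝ} (hK : IsSmooth K) (hK0 : ∀ x, 0 < K x)
    {k α₁ α₂ η : ℝ}
    (hk : 0 < k)
    (hh : ∀ x, x ≠ p → x ≠ -p → h x = k * (K x * ((1 - dot x p) ^ α₁ * (1 + dot x p) ^ α₂)))
    (h₁ : η ≤ 1 + α₁) (h₂ : η ≤ 1 + α₂) :
    ∃ C : ℝ, 0 ≤ C ∧ ∀ x, x ≠ p → x ≠ -p → h x ≤ C * (1 - dot x p ^ 2) ^ (-(1 - η)) := by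
  have hKc : Continuous K := ContMDiff.continuous hK
  obtain ⟨D, hD⟩ := (isCompact_univ (X := S2)).exists_bound_of_continuousOn hKc.continuousOn
  have hD0 : 0 ≤ D := (norm_nonneg _).trans (hD p (mem_univ p))
  refine ⟨k * (D * (2 ^ (1 + α₁ - η) * 2 ^ (1 + α₂ - η))), by positivity, fun x hx hx' => ?_⟩
  have e1 : 0 < 1 - dot x p := by linarith [dot_lt_one hx]
  have e2 : 0 < 1 + dot x p := by linarith [neg_one_lt_dot hx']
  have hsq : 1 - dot x p ^ 2 = (1 - dot x p) * (1 + dot x p) := by ring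
  have f1 : (1 - dot x p) ^ α₁ ≤ 2 ^ (1 + α₁ - η) * (1 - dot x p) ^ (-(1 - η)) := by
    have : (1 - dot x p) ^ α₁ = (1 - dot x p) ^ (1 + α₁ - η) * (1 - dot x p) ^ (-(1 - η)) := by
      rw [← Real.rpow_add e1]; congr 1; ring
    rw [this]
    gcongr
    linarith [neg_one_le_dot x p]
  have f2 : (1 + dot x p) ^ α₂ ≤ 2 ^ (1 + α₂ - η) * (1 + dot x p) ^ (-(1 - η)) := by
    have : (1 + dot x p) ^ α₂ = (1 + dot x p) ^ (1 + α₂ - η) * (1 + dot x p) ^ (-(1 - η)) := by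
      rw [← Real.rpow_add e2]; congr 1; ring
    rw [this]
    gcongr
    linarith [dot_le_one x p]
  have hKD : K x ≤ D := (le_abs_self _).trans (hD x (mem_univ x))
  have hKx := hK0 x
  rw [hh x hx hx', hsq, Real.mul_rpow e1.le e2.le]
  calc k * (K x * ((1 - dot x p) ^ α₁ * (1 + dot x p) ^ α₂))
      ≤ k * (D * ((2 ^ (1 + α₁ - η) * (1 - dot x p) ^ (-(1 - η))) *
          (2 ^ (1 + α₂ - η) * (1 + dot x p) ^ (-(1 - η))))) := by gcongr
    _ = _ := by ring

/-! ### Solutions as potentials -/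

/-- A solution is the logarithmic potential of its right-hand side. -/
lemma IsSolution.ae_eq {h u : S2 → ℝ} {ρ : ℝ} (hu : IsSolution h ρ u) (hρ : 0 ≤ ρ)
    (hh : ∀ x, 0 < h x) (hM : 0 < ∫ x, h x * Real.exp (u x) ∂area) :
    ∃ c : ℝ, ∀ᵐ y ∂area, u y = c - ρ / (4 * Real.pi * ∫ x, h x * Real.exp (u x) ∂area) *
      ∫ x, h x * Real.exp (u x) * Real.log (1 - dot x y) ∂area := by
  set f : S2 → ℝ := fun x => h x * Real.exp (u x) with hfdef
  set M := ∫ x, f x ∂area with hMdef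
  have hf : Integrable f area := hu.integrable_exp
  have hf0 : ∀ x, 0 ≤ f x := fun x => (mul_pos (hh x) (Real.exp_pos _)).le
  set μ : Measure S2 := area.withDensity fun x => ENNReal.ofReal (ρ / M * f x) with hμ
  have hρM : 0 ≤ ρ / M := by positivity
  have hint : ∀ φ : S2 → ℝ, ∫ x, φ x ∂μ = ρ / M * ∫ x, f x * φ x ∂area := fun φ => by
    rw [hμ, integral_withDensity_eq_integral_toReal_smul₀
      (hf.const_mul _).aestronglyMeasurable.aemeasurable.ennreal_ofReal
      (.of_forall fun x => ENNReal.ofReal_lt_top), ← integral_const_mul]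
    refine integral_congr_ae (.of_forall fun x => ?_)
    simp only [smul_eq_mul, ENNReal.toReal_ofReal (mul_nonneg hρM (hf0 x)), mul_assoc]
  have hfin : IsFiniteMeasure μ := isFiniteMeasure_withDensity_ofReal (hf.const_mul _).2
  have hmass : μ.real univ = ρ := by
    have := hint fun _ => 1
    simp only [integral_const, smul_eq_mul, mul_one] at this
    rw [this, ← hMdef]
    field_simp
  have hlap : HasLaplacian u μ := fun φ hφ => by
    rw [hu.equation φ hφ, hint, hmass]
    ring
  obtain ⟨c, hc⟩ := hlap.ae_eq hu.integrable
  refine ⟨c, hc.mono fun y hy => ?_⟩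
  rw [hy, hint]
  field_simp
  rfl

end SingularLiouville

open SingularLiouville in
theorem mainTheorem5
    (p₁ p₂ : SingularLiouville.S2)
    (hp₁ : (p₁ : EuclideanSpace ℝ (Fin 3)) = !₂[0, 0, 1]) (hp₂ : p₂ = -p₁)
    (G₁ G₂ : SingularLiouville.S2 → ℝ)
    (hG₁ : SingularLiouville.IsGreenFunction p₁ G₁)
    (hG₂ : SingularLiouville.IsGreenFunction p₂ G₂)
    (α₁ α₂ : ℝ) (hα₁ : -1 < α₁) (hα₂ : -1 < α₂)
    (K : SingularLiouville.S2 → ℝ) (hK : SingularLiouville.IsSmooth K) (hKpos : ∀ x, 0 < K x)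
    (ρ : ℝ) (hρ : 0 < ρ)
    (h : SingularLiouville.S2 → ℝ) (hh : h = SingularLiouville.weight K G₁ G₂ α₁ α₂)
    (u : SingularLiouville.S2 → ℝ) (hu : SingularLiouville.IsSolution h ρ u) :
    Integrable (fun x => inner ℝ (SingularLiouville.grad h x)
      (SingularLiouville.grad SingularLiouville.x3 x) * Real.exp (u x)) SingularLiouville.area ∧
    Integrable (fun x => h x * Real.exp (u x) * SingularLiouville.x3 x) SingularLiouville.area ∧
    ∫ x, inner ℝ (SingularLiouville.grad h x)
        (SingularLiouville.grad SingularLiouville.x3 x) * Real.exp (u x) ∂SingularLiouville.area =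
      (2 - ρ / (4 * Real.pi)) *
        ∫ x, h x * Real.exp (u x) * SingularLiouville.x3 x ∂SingularLiouville.area := by
  have hpi := Real.pi_pos
  subst hp₂
  have hx3 : x3 = fun x => dot x p₁ := by
    funext x
    simp [x3, dot, hp₁, PiLp.inner_apply, Fin.sum_univ_three]
  rw [hx3]
  have hh0 : ∀ x, 0 < h x := fun x => by
    rw [hh]; exact mul_pos (hKpos x) (Real.exp_pos _)
  obtain ⟨k, hk, hhk⟩ := weight_eq (K := K) hG₁ hG₂ α₁ α₂
  rw [← hh] at hhk
  have hf : Integrable (fun x => h x * Real.exp (u x)) area := hu.integrable_exp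
  have hf0 : ∀ x, 0 < h x * Real.exp (u x) := fun x => mul_pos (hh0 x) (Real.exp_pos _)
  have hM : 0 < ∫ x, h x * Real.exp (u x) ∂area := by
    rw [integral_pos_iff_support_of_nonneg (fun x => (hf0 x).le) hf]
    have : Function.support (fun x => h x * Real.exp (u x)) = Set.univ :=
      Set.eq_univ_of_forall fun x => (hf0 x).ne'
    rw [this]
    exact isOpen_univ.measure_pos area ⟨p₁, trivial⟩
  obtain ⟨c, hc⟩ := hu.ae_eq hρ.le hh0 hM
  set M := ∫ x, h x * Real.exp (u x) ∂area with hMdef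
  set b := ρ / (4 * Real.pi * M) with hb
  have hb0 : 0 < b := by positivity
  set B := weightLogDeriv p₁ K α₁ α₂
  have hBc : Continuous B := continuous_weightLogDeriv p₁ hK hKpos α₁ α₂
  obtain ⟨β, hβ⟩ := (isCompact_univ (X := S2)).exists_bound_of_continuousOn hBc.continuousOn
  have hgrad : ∀ x, x ≠ p₁ → x ≠ -p₁ →
      inner ℝ (grad h x) (grad (fun x => dot x p₁) x) = h x * B x :=
    fun x h1 h2 => inner_grad_weight hK hKpos hhk h1 h2
  have hae : (fun x => inner ℝ (grad h x) (grad (fun x => dot x p₁) x) * Real.exp (u x)) =ᵐ[area]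
      fun x => h x * Real.exp (u x) * B x := by
    filter_upwards [ae_ne_poles p₁] with x hx
    rw [hgrad x hx.1 hx.2]
    ring
  refine ⟨(hf.mul_bdd hBc.aestronglyMeasurable (.of_forall fun x => hβ x trivial)).congr hae.symm,
    hf.mul_bdd (c := 1) (continuous_dot_left p₁).aestronglyMeasurable
      (.of_forall fun x => abs_dot_le_one x p₁), ?_⟩
  rw [integral_congr_ae hae]
  -- an exponent `η` for which the weight is `O(r ^ (-2 + 2 η))`, `r` the distance to the axis
  set η := min (min (1 + α₁) (1 + α₂)) (1 / 4) with hη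
  have hη0 : 0 < η := lt_min (lt_min (by linarith) (by linarith)) (by norm_num)
  have hη4 : η ≤ 1 / 4 := min_le_right _ _
  obtain ⟨C, hC0, hC⟩ := exists_weight_le hK hKpos hk hhk
    ((min_le_left _ _).trans (min_le_left _ _) : η ≤ 1 + α₁)
    ((min_le_left _ _).trans (min_le_right _ _) : η ≤ 1 + α₂)
  have hexp := integrable_weight_mul_exp_potential p₁ hf (fun x => (hf0 x).le) hη0
    (by linarith) (show 0 < 2 * b by positivity)
  have hH : Integrable (fun x => (h x * Real.exp (u x)) ^ 2 * (1 - dot x p₁ ^ 2) ^ (1 - η))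
      area := by
    refine (hexp.const_mul (C ^ 2 * Real.exp (2 * c))).mono' ?_ ?_
    · exact (hf.aestronglyMeasurable.pow 2).mul
        ((((continuous_dot_left p₁).pow 2).measurable.const_sub 1).pow_const _).aestronglyMeasurable
    · filter_upwards [hc, ae_ne_poles p₁] with x hx hxp
      have hq := one_sub_sq_dot_pos hxp
      have hq' := Real.rpow_pos_of_pos hq (-(1 - η))
      have e1 : (1 - dot x p₁ ^ 2) ^ (-(1 - η)) * (1 - dot x p₁ ^ 2) ^ (1 - η) = 1 := by
        rw [← Real.rpow_add hq, neg_add_cancel, Real.rpow_zero]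
      have e2 : Real.exp (u x) ^ 2 = Real.exp (2 * c) * Real.exp
          (-(2 * b * ∫ y, h y * Real.exp (u y) * Real.log (1 - dot y x) ∂area)) := by
        rw [← Real.exp_add, ← Real.exp_nat_mul, hx]
        congr 1
        push_cast
        ring
      have e3 := hC x hxp.1 hxp.2
      have e4 := (hh0 x).le
      rw [Real.norm_of_nonneg (by positivity), mul_pow, e2]
      generalize Real.exp (-(2 * b * ∫ y, h y * Real.exp (u y) * Real.log (1 - dot y x) ∂area)) = E
        at *
      have hE : 0 ≤ Real.exp (2 * c) * E := e2 ▸ sq_nonneg _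
      calc h x ^ 2 * (Real.exp (2 * c) * E) * (1 - dot x p₁ ^ 2) ^ (1 - η)
          ≤ (C * (1 - dot x p₁ ^ 2) ^ (-(1 - η))) ^ 2 * (Real.exp (2 * c) * E)
              * (1 - dot x p₁ ^ 2) ^ (1 - η) := by gcongr
        _ = C ^ 2 * Real.exp (2 * c) * ((1 - dot x p₁ ^ 2) ^ (-(1 - η)) * E) *
              ((1 - dot x p₁ ^ 2) ^ (-(1 - η)) * (1 - dot x p₁ ^ 2) ^ (1 - η)) := by ring
        _ = _ := by rw [e1, mul_one]
  have hI := integrable_interaction p₁ hf (fun x => (hf0 x).le) hη0 (by linarith) hH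
  have key := pohozaev_identity p₁ hh0 hu.integrable.aestronglyMeasurable hf
    (fun x h1 h2 => by
      rw [← hgrad x h1 h2]
      exact hasLineDerivAt_inner_grad p₁ (differentiableAt_radialExt_weight hK hhk h1 h2))
    hBc.aestronglyMeasurable (fun x => hβ x trivial) hb0.le hc hI
  rw [← hMdef] at key
  have hbM : b * (M * ∫ x, h x * Real.exp (u x) * dot x p₁ ∂area) =
      ρ / (4 * Real.pi) * ∫ x, h x * Real.exp (u x) * dot x p₁ ∂area := by
    rw [hb]
    field_simp
  rw [hbM] at key
  linarith
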